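/- Let $n\ge 0$, let $(\widehat M,\widehat g)$ be a semi-Riemannian manifold of dimension $n+1$ (smooth, without boundary, Hausdorff, second countable; $\widehat g$ a smooth symmetric nondegenerate $(0,2)$-tensor field, of arbitrary signature), and let $F:\widehat M\to\mathbb R$ be smooth. Let $\overline M=\mathbb R\times\widehat M$ with the metric $\overline g=-dx^0\otimes dx^0+\pi^*\widehat g$, where $\pi:\overline M\to\widehat M$ is the projection and $x^0$ the coordinate of $\mathbb R$, let $\overline\nabla$ be its Levi-Civita connection, and let $i: M=\{(t,p)\in\overline M: t=F(p)\}\hookrightarrow\overline M$, $g=i^*\overline g$, be the associated Monge-type hypersurface. Assume that the generator $(\widehat M,\widehat g,F)$ is degenerate, i.e. that the radical spaces $\mathrm{Rad}\,T_qM=\{u\in T_qM: g(u,v)=0\ \forall v\in T_qM\}$ have a constant dimension $r>0$ and form a smooth distribution on $M$. A *screen distribution* is a smooth distribution $S(TM)\subset TM$ with $TM=S(TM)\oplus \mathrm{Rad}\,TM$ (here $\mathrm{Rad}\,TM=TM^\perp$). The hypersurface $M$ with screen distribution $S(TM)$ is *minimal* if, for every nonvanishing local section $\xi$ of $TM^\perp$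 and every local $g$-orthonormal frame $\{E_i\}$ of $S(TM)$ on a common open subset of $M$, one has there $\sum_i g(E_i,E_i)\,B_\xi(E_i,E_i)=0$, where $B_\xi(X,Y)=\overline g(\overline\nabla_XY,\xi)$. Then the canonical screen $\{u\in TM:\overline g(u,\partial/\partial x^0)=0\}$ is a screen distribution and, for every screen distribution $S(TM)$ of $M$ (in particular for the canonical one), $M$ is minimal if and only if for every $\widehat p\in\widehat M$ there exist an open neighborhood $\widehat U$ of $\widehat p$ and a smooth $\widehat g$-orthonormal frame $\{\widehat E_i\}_{i=1}^n$ of $\ker dF|_{\widehat U}$ such that on $\widehat U$ $$\sum_{i=1}^n\varepsilon_i\,\mathrm{Hess}(F)(\widehat E_i,\widehat E_i)=0,\qquad \varepsilon_i=\widehat g(\widehat E_i,\widehat E_i)\in\{-1,1\},$$ where $\mathrm{Hess}(F)(X,Y)=X(YF)-(\widehat\nabla_XY)F$ and $\widehat\nabla$ is the Levi-Civita connection of $\widehat g$. -/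

import Mathlib

open Set Filter Bundle Topology
open scoped Manifold ContDiff

namespace MongeType

noncomputable section

/-- The bilinear form `(v, w) ↦ b (L v) (L w)`. -/
def compBilin {V W : Type*} [AddCommGroup V] [Module ℝ V] [TopologicalSpace V]
    [IsTopologicalAddGroup V] [ContinuousConstSMul ℝ V]
    [AddCommGroup W] [Module ℝ W] [TopologicalSpace W]
    [IsTopologicalAddGroup W] [ContinuousConstSMul ℝ W]
    (b : W →L[ℝ] W →L[ℝ] ℝ) (L : V →L[ℝ] W) : V →L[ℝ] V →L[ℝ] ℝ :=
  (ContinuousLinearMap.precomp ℝ L) ∘L b ∘L L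

@[simp]
theorem compBilin_apply {V W : Type*} [AddCommGroup V] [Module ℝ V] [TopologicalSpace V]
    [IsTopologicalAddGroup V] [ContinuousConstSMul ℝ V]
    [AddCommGroup W] [Module ℝ W] [TopologicalSpace W]
    [IsTopologicalAddGroup W] [ContinuousConstSMul ℝ W]
    (b : W →L[ℝ] W →L[ℝ] ℝ) (L : V →L[ℝ] W) (v w : V) :
    compBilin b L v w = b (L v) (L w) := rfl

section Metric

variable {E : Type*} [NormedAddCommGroup E] [NormedSpace ℝ E]
  {H : Type*} [TopologicalSpace H] (I : ModelWithCorners ℝ E H)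
  (M : Type*) [TopologicalSpace M] [ChartedSpace H M]

/-- Fields of bilinear forms on the tangent spaces of `M`. -/
abbrev BilinField : Type _ :=
  Π x : M, TangentSpace I x →L[ℝ] TangentSpace I x →L[ℝ] ℝ

variable {I M}

/-- Smoothness of a field of bilinear forms, i.e. of a `(0,2)`-tensor field. -/
def IsSmoothBilin [IsManifold I ∞ M] (b : BilinField I M) : Prop :=
  ContMDiff I (I.prod 𝓘(ℝ, E →L[ℝ] E →L[ℝ] ℝ)) ∞
    (fun x ↦ TotalSpace.mk' (E →L[ℝ] E →L[ℝ] ℝ)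
      (E := fun x : M ↦ TangentSpace I x →L[ℝ] TangentSpace I x →L[ℝ] ℝ) x (b x))

/-- The field `b` read in the tangent coordinates given by the preferred chart at `x`:
its component matrix `(b_{ij})` at the nearby point `y`, as a bilinear form on the model space. -/
def coordBilin [IsManifold I 1 M] (b : BilinField I M) (x y : M) : E →L[ℝ] E →L[ℝ] ℝ :=
  compBilin (b y) ((trivializationAt E (TangentSpace I) x).symmL ℝ y)

theorem isSmoothBilin_iff [IsManifold I ∞ M] (b : BilinField I M) :
    IsSmoothBilin b ↔ ∀ x, ContMDiffAt I 𝓘(ℝ, E →L[ℝ] E →L[ℝ] ℝ) ∞ (coordBilin b x) x := by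
  refine forall_congr' fun x ↦ ?_
  rw [contMDiffAt_hom_bundle]
  have : (fun y ↦ ContinuousLinearMap.inCoordinates E (TangentSpace I : M → Type _)
      (E →L[ℝ] ℝ) (fun x : M ↦ TangentSpace I x →L[ℝ] ℝ) x y x y (b y)) =ᶠ[𝓝 x]
      coordBilin b x := by
    filter_upwards [(trivializationAt E (TangentSpace I) x).open_baseSet.mem_nhds
      (mem_baseSet_trivializationAt E (TangentSpace I) x)] with y hy
    ext v w
    rw [inCoordinates_apply_eq₂ hy hy (mem_univ _)]
    simp [coordBilin, Trivialization.symmL_apply _ hy]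
  refine ⟨fun h ↦ h.2.congr_of_eventuallyEq this.symm, fun h ↦ ⟨contMDiffAt_id, ?_⟩⟩
  exact h.congr_of_eventuallyEq this

variable {E' : Type*} [NormedAddCommGroup E'] [NormedSpace ℝ E']
  {H' : Type*} [TopologicalSpace H'] {I' : ModelWithCorners ℝ E' H'}
  {M' : Type*} [TopologicalSpace M'] [ChartedSpace H' M']

/-- The pullback `f^* b` of a field of bilinear forms. -/
def pullbackBilin (f : M → M') (b : BilinField I' M') : BilinField I M :=
  fun x ↦ compBilin (b (f x)) (mfderiv I I' f x)

theorem IsSmoothBilin.pullback [IsManifold I ∞ M] [IsManifold I' ∞ M'] {f : M → M'}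
    (hf : ContMDiff I I' ∞ f) {b : BilinField I' M'} (hb : IsSmoothBilin b) :
    IsSmoothBilin (pullbackBilin (I := I) f b) := by
  rw [isSmoothBilin_iff] at hb ⊢
  intro x
  have hA : ContMDiffAt I 𝓘(ℝ, E →L[ℝ] E') ∞
      (inTangentCoordinates I I' id f (mfderiv I I' f) x) x :=
    (hf x).mfderiv_const (by simp)
  have hB := ((hb (f x)).comp x (hf x))
  set A := inTangentCoordinates I I' id f (mfderiv I I' f) x
  have key : (fun y ↦ compBilin (coordBilin b (f x) (f y)) (A y)) =ᶠ[𝓝 x]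
      coordBilin (pullbackBilin (I := I) f b) x := by
    filter_upwards [(trivializationAt E (TangentSpace I) x).open_baseSet.mem_nhds
      (mem_baseSet_trivializationAt E (TangentSpace I) x),
      hf.continuous.continuousAt ((trivializationAt E' (TangentSpace I') (f x)).open_baseSet.mem_nhds
      (mem_baseSet_trivializationAt E' (TangentSpace I') (f x)))] with y hy hy'
    ext v w
    have hA' : ∀ u, (trivializationAt E' (TangentSpace I') (f x)).symmL ℝ (f y) (A y u) =
        mfderiv I I' f y ((trivializationAt E (TangentSpace I) x).symmL ℝ y u) := by
      intro u
      simp only [A, inTangentCoordinates, id]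
      rw [ContinuousLinearMap.inCoordinates_eq hy hy', Trivialization.symmL_apply _ hy',
        Trivialization.symmL_apply _ hy]
      exact Trivialization.symm_apply_apply_mk
        (trivializationAt E' (TangentSpace I' : M' → Type _) (f x)) hy' _
    simp only [coordBilin, compBilin_apply, pullbackBilin, hA']
  refine ContMDiffAt.congr_of_eventuallyEq ?_ key.symm
  exact (hA.clm_precomp (F₃ := ℝ)).clm_comp (hB.clm_comp hA)


variable (I M) in
/-- A semi-Riemannian metric: a smooth field of symmetric nondegenerate bilinear forms. -/
structure SemiRiemannianMetric [IsManifold I ∞ M] where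
  form : BilinField I M
  smooth : IsSmoothBilin form
  symm : ∀ (x : M) (v w : TangentSpace I x), form x v w = form x w v
  nondegenerate : ∀ (x : M) (v : TangentSpace I x), (∀ w, form x v w = 0) → v = 0

/-- The components, in the tangent coordinates given by the preferred chart at `x`, of a tangent
vector at a nearby point. -/
def coordVec [IsManifold I 1 M] (x : M) (v : TangentBundle I M) : E :=
  (trivializationAt E (TangentSpace I : M → Type _) x v).2

/-- The tangent vector at `x` with components `a` in the preferred chart at `x`. -/
def ofCoord [IsManifold I 1 M] (x : M) : E →L[ℝ] TangentSpace I x :=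
  (trivializationAt E (TangentSpace I : M → Type _) x).symmL ℝ x

/-- The partial derivatives at `x` of the components of `b` in the preferred chart at `x`:
`partialBilin b x u v w` is `u^k v^i w^j ∂_k b_{ij}`. -/
def partialBilin [IsManifold I 1 M] (b : BilinField I M) (x : M) : E →L[ℝ] E →L[ℝ] E →L[ℝ] ℝ :=
  (mvfderiv I (coordBilin b x) x) ∘L ofCoord x

/-- The Christoffel symbols of `b` at `x` in the preferred chart at `x`: `christoffel b x u v` is the
vector `u^i v^j Γ^k_{ij}`, where `2 b_{kl} Γ^k_{ij} = ∂_i b_{jl} + ∂_j b_{il} - ∂_l b_{ij}`.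
(The inverse is a junk value when `b` is degenerate at `x`.) -/
def christoffel [IsManifold I 1 M] (b : BilinField I M) (x : M) (u v : E) : E :=
  (coordBilin b x x).inverse ((1 / 2 : ℝ) • (partialBilin b x u v + partialBilin b x v u
    - ((partialBilin b x).flip u).flip v))

variable {EN : Type*} [NormedAddCommGroup EN] [NormedSpace ℝ EN]
  {HN : Type*} [TopologicalSpace HN] {J : ModelWithCorners ℝ EN HN}
  {N : Type*} [TopologicalSpace N] [ChartedSpace HN N]

/-- The covariant derivative `∇_u Z`, with respect to the Levi-Civita connection of `b`, of a vector
field `Z` along a map `f : N → M`, in the direction `u ∈ T_y N`. In the preferred chart at `f y`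
it is `(∇_u Z)^k = u(Z^k) + Γ^k_{ij} (df u)^i Z^j`. -/
def covDerivAlong [IsManifold I 1 M] (b : BilinField I M) (f : N → M)
    (Z : Π y : N, TangentSpace I (f y)) (y : N) (u : TangentSpace J y) : TangentSpace I (f y) :=
  ofCoord (f y) (mvfderiv J (fun z ↦ coordVec (f y) ⟨f z, Z z⟩) y u +
    christoffel b (f y) (coordVec (f y) ⟨f y, mfderiv J I f y u⟩) (coordVec (f y) ⟨f y, Z y⟩))

/-- The Levi-Civita connection `(∇_X Y)(x)` of `b`. -/
def leviCivita [IsManifold I 1 M] (b : BilinField I M) (X Y : Π x : M, TangentSpace I x) (x : M) :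
    TangentSpace I x :=
  covDerivAlong (J := I) b (id : M → M) Y x (X x)

/-- The Hessian `Hess(F)(X, Y) = X(Y F) - (∇_X Y) F`. -/
def hess [IsManifold I 1 M] (b : BilinField I M) (F : M → ℝ) (X Y : Π x : M, TangentSpace I x)
    (x : M) : ℝ :=
  mvfderiv I (fun y ↦ mvfderiv I F y (Y y)) x (X x) - mvfderiv I F x (leviCivita b X Y x)


end Metric


section Lightlike

variable {E : Type*} [NormedAddCommGroup E] [NormedSpace ℝ E]
  {H : Type*} [TopologicalSpace H] {I : ModelWithCorners ℝ E H}
  {M : Type*} [TopologicalSpace M] [ChartedSpace H M]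
  {EN : Type*} [NormedAddCommGroup EN] [NormedSpace ℝ EN]
  {HN : Type*} [TopologicalSpace HN] {J : ModelWithCorners ℝ EN HN}
  {N : Type*} [TopologicalSpace N] [ChartedSpace HN N]

/-- The vector field `Z` along `f : N → M` is smooth on `U`. (For `f = id`: a vector field.) -/
def IsSmoothAlongOn [IsManifold I 1 M] (J : ModelWithCorners ℝ EN HN) (f : N → M)
    (Z : Π y : N, TangentSpace I (f y)) (U : Set N) : Prop :=
  ContMDiffOn J I.tangent ∞ (fun y ↦ (⟨f y, Z y⟩ : TangentBundle I M)) U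

/-- A smooth distribution: a field of tangent subspaces with smooth local frames. -/
def IsSmoothDistribution [IsManifold J 1 N] (D : Π y : N, Submodule ℝ (TangentSpace J y)) : Prop :=
  ∀ y : N, ∃ U : Set N, IsOpen U ∧ y ∈ U ∧
    ∃ (k : ℕ) (s : Fin k → Π z : N, TangentSpace J z),
      (∀ j, IsSmoothAlongOn J id (s j) U) ∧
      ∀ z ∈ U, LinearIndependent ℝ (fun j ↦ s j z) ∧
        Submodule.span ℝ (range fun j ↦ s j z) = D z

/-- The radical space `{u ∈ T_y N | b(u, v) = 0 for all v ∈ T_y N}`. -/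
def radical (b : BilinField J N) (y : N) : Submodule ℝ (TangentSpace J y) :=
  LinearMap.ker (b y : TangentSpace J y →ₗ[ℝ] (TangentSpace J y →L[ℝ] ℝ))

/-- `(N, b)` is a lightlike (degenerate) manifold: the radical spaces have constant positive
dimension and form a smooth distribution. -/
def IsLightlike [IsManifold J 1 N] (b : BilinField J N) : Prop :=
  (∃ r : ℕ, 0 < r ∧ ∀ y, Module.finrank ℝ (radical b y) = r) ∧ IsSmoothDistribution (radical b)

/-- The normal space `T_y N^⊥ = {ξ ∈ T_{f y} M | b(ξ, df v) = 0 for all v ∈ T_y N}` of the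
submanifold `f : N → M`. -/
def normalSpace (J : ModelWithCorners ℝ EN HN) (b : BilinField I M) (f : N → M) (y : N) :
    Submodule ℝ (TangentSpace I (f y)) where
  carrier := {ξ | ∀ v : TangentSpace J y, b (f y) ξ (mfderiv J I f y v) = 0}
  add_mem' h h' v := by simp [h v, h' v]
  zero_mem' v := by simp
  smul_mem' c _ h v := by simp [h v]

/-- A screen distribution of the lightlike manifold `(N, b)`: a smooth distribution `S` with
`TN = S ⊕ Rad TN`. (For a lightlike hypersurface `Rad TN = TN^⊥`.) -/
def IsScreenDistribution [IsManifold J 1 N] (b : BilinField J N)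
    (S : Π y : N, Submodule ℝ (TangentSpace J y)) : Prop :=
  IsSmoothDistribution S ∧ ∀ y, IsCompl (S y) (radical b y)

/-- `e_1, …, e_k` is a smooth orthonormal frame, with respect to `b`, of the distribution `D`
over `U`. -/
structure IsOrthonormalFrameOn [IsManifold J 1 N] (b : BilinField J N)
    (D : Π y : N, Submodule ℝ (TangentSpace J y)) (U : Set N) {k : ℕ}
    (e : Fin k → Π y : N, TangentSpace J y) : Prop where
  smooth : ∀ j, IsSmoothAlongOn J id (e j) U
  span_eq : ∀ y ∈ U, Submodule.span ℝ (range fun j ↦ e j y) = D y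
  orthogonal : ∀ y ∈ U, ∀ j l, j ≠ l → b y (e j y) (e l y) = 0
  unit : ∀ y ∈ U, ∀ j, b y (e j y) (e j y) = 1 ∨ b y (e j y) (e j y) = -1

/-- The second fundamental form `B_ξ(X, Y) = b(∇_X Y, ξ)` of `f : N → M` with respect to a normal
field `ξ`, where `X`, `Y` are tangent vector fields of `N` and `∇` is the Levi-Civita connection of
the ambient metric `b`. -/
def secondFundamentalForm [IsManifold I 1 M] (b : BilinField I M) (f : N → M)
    (ξ : Π y : N, TangentSpace I (f y)) (X Y : Π y : N, TangentSpace J y) (y : N) : ℝ :=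
  b (f y) (covDerivAlong b f (fun z ↦ mfderiv J I f z (Y z)) y (X y)) (ξ y)

/-- The lightlike hypersurface `f : N → M` of `(M, b)`, with screen distribution `S`, is minimal:
`∑ ε_j B_ξ(e_j, e_j) = 0` for every local nonvanishing section `ξ` of the normal bundle and every
local orthonormal frame `e_j` of `S`, where `ε_j = g(e_j, e_j)` for the induced metric `g`. -/
def IsMinimal [IsManifold I 1 M] [IsManifold J 1 N] (b : BilinField I M) (f : N → M)
    (S : Π y : N, Submodule ℝ (TangentSpace J y)) : Prop :=
  ∀ U : Set N, IsOpen U →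
    ∀ ξ : Π y : N, TangentSpace I (f y), IsSmoothAlongOn J f ξ U →
      (∀ y ∈ U, ξ y ∈ normalSpace J b f y ∧ ξ y ≠ 0) →
    ∀ (k : ℕ) (e : Fin k → Π y : N, TangentSpace J y),
      IsOrthonormalFrameOn (pullbackBilin f b) S U e →
    ∀ y ∈ U, ∑ j, pullbackBilin (I := J) f b y (e j y) (e j y) *
      secondFundamentalForm b f ξ (e j) (e j) y = 0

end Lightlike

section Monge

variable {E : Type*} [NormedAddCommGroup E] [NormedSpace ℝ E]
  {H : Type*} [TopologicalSpace H] {I : ModelWithCorners ℝ E H}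
  {M : Type*} [TopologicalSpace M] [ChartedSpace H M]

/-- The hypersurface `{(t, p) ∈ ℝ × M | t = F p}`. -/
def Hypersurface (F : C^∞⟮I, M; 𝓘(ℝ, ℝ), ℝ⟯) : Type _ := {q : ℝ × M // q.1 = F q.2}

namespace Hypersurface

variable (F : C^∞⟮I, M; 𝓘(ℝ, ℝ), ℝ⟯)

instance : TopologicalSpace (Hypersurface F) :=
  inferInstanceAs (TopologicalSpace {q : ℝ × M // q.1 = F q.2})

/-- The inclusion of the hypersurface in `ℝ × M`. -/
def incl : Hypersurface F → ℝ × M := Subtype.val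

/-- The projection of the hypersurface to `M`, which is a homeomorphism. -/
def proj : Hypersurface F ≃ₜ M where
  toFun q := q.1.2
  invFun p := ⟨(F p, p), rfl⟩
  left_inv := by rintro ⟨⟨t, p⟩, h⟩; exact Subtype.ext (Prod.ext h.symm rfl)
  right_inv _ := rfl
  continuous_toFun := continuous_snd.comp continuous_subtype_val
  continuous_invFun := (F.contMDiff.continuous.prodMk continuous_id).subtype_mk _

/-- The manifold structure of the hypersurface: its charts are those of `M` composed with the
projection. -/
instance : ChartedSpace H (Hypersurface F) where
  atlas := {c | ∃ e ∈ atlas H M, c = (proj F).transOpenPartialHomeomorph e}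
  chartAt q := (proj F).transOpenPartialHomeomorph (chartAt H (proj F q))
  mem_chart_source q := by simp
  chart_mem_atlas q := ⟨_, chart_mem_atlas H _, rfl⟩

instance (n : ℕ∞ω) [IsManifold I n M] : IsManifold I n (Hypersurface F) := by
  refine { compatible := ?_ }
  rintro _ _ ⟨e, he, rfl⟩ ⟨e', he', rfl⟩
  have : ((proj F).transOpenPartialHomeomorph e).symm ≫ₕ (proj F).transOpenPartialHomeomorph e' =
      e.symm ≫ₕ e' := by
    ext1 <;> simp [preimage_preimage, Function.comp_def]
  rw [this]
  exact HasGroupoid.compatible he he'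

end Hypersurface

/-- The field of bilinear forms `-dt ⊗ dt` on the real line. -/
def lineForm : BilinField 𝓘(ℝ, ℝ) ℝ :=
  fun _ ↦ (-ContinuousLinearMap.mul ℝ ℝ : ℝ →L[ℝ] ℝ →L[ℝ] ℝ)

/-- The field of bilinear forms `-dx⁰ ⊗ dx⁰ + π^* b` on `ℝ × M`. -/
def ambientForm (b : BilinField I M) : BilinField (𝓘(ℝ, ℝ).prod I) (ℝ × M) :=
  fun q ↦ pullbackBilin (I := 𝓘(ℝ, ℝ).prod I) (Prod.fst : ℝ × M → ℝ) lineForm q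
    + pullbackBilin (I := 𝓘(ℝ, ℝ).prod I) (Prod.snd : ℝ × M → M) b q

theorem ambientForm_apply (b : BilinField I M) (q : ℝ × M)
    (v w : TangentSpace (𝓘(ℝ, ℝ).prod I) q) :
    ambientForm b q v w = -((v : ℝ × E).1 * (w : ℝ × E).1) + b q.2 (v : ℝ × E).2 (w : ℝ × E).2 := by
  unfold ambientForm pullbackBilin
  rw [mfderiv_fst, mfderiv_snd]
  rfl

variable [IsManifold I ∞ M]

theorem isSmoothBilin_lineForm : IsSmoothBilin lineForm := by
  rw [isSmoothBilin_iff]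
  intro x
  have : coordBilin lineForm x = fun _ ↦ (-ContinuousLinearMap.mul ℝ ℝ : ℝ →L[ℝ] ℝ →L[ℝ] ℝ) := by
    funext y
    unfold coordBilin
    rw [TangentBundle.symmL_model_space]
    rfl
  rw [this]
  exact contMDiffAt_const

theorem isSmoothBilin_ambientForm {b : BilinField I M} (hb : IsSmoothBilin b) :
    IsSmoothBilin (ambientForm b) := by
  have h2 := isSmoothBilin_lineForm.pullback (I := 𝓘(ℝ, ℝ).prod I)
    (f := (Prod.fst : ℝ × M → ℝ)) contMDiff_fst
  have h3 := hb.pullback (I := 𝓘(ℝ, ℝ).prod I) (f := (Prod.snd : ℝ × M → M)) contMDiff_snd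
  rw [isSmoothBilin_iff] at h2 h3 ⊢
  exact fun x ↦ (h2 x).add (h3 x)

/-- The ambient metric `-dx⁰ ⊗ dx⁰ + π^* g` on `ℝ × M`. -/
def ambientMetric (g : SemiRiemannianMetric I M) :
    SemiRiemannianMetric (𝓘(ℝ, ℝ).prod I) (ℝ × M) where
  form := ambientForm g.form
  smooth := isSmoothBilin_ambientForm g.smooth
  symm q v w := by
    rw [ambientForm_apply, ambientForm_apply, mul_comm]
    exact congrArg _ (g.symm _ _ _)
  nondegenerate q v h := by
    refine Prod.ext ?_ (g.nondegenerate q.2 (v : ℝ × E).2 fun w ↦ ?_)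
    · have h1 := (ambientForm_apply g.form q v ((1, 0) : ℝ × E)).symm.trans (h _)
      have h2 : g.form q.2 (v : ℝ × E).2 (0 : E) = 0 := (g.form q.2 _).map_zero
      have h3 : -((v : ℝ × E).1 * 1) + g.form q.2 (v : ℝ × E).2 (0 : E) = 0 := h1
      have h4 : (v : ℝ × E).1 = 0 := by linarith
      exact h4
    · have h1 := (ambientForm_apply g.form q v ((0, w) : ℝ × E)).symm.trans (h _)
      have h3 : -((v : ℝ × E).1 * 0) + g.form q.2 (v : ℝ × E).2 w = 0 := h1
      linarith

/-- The induced (degenerate) metric `g = i^* ḡ` on the hypersurface `{t = F p}`. -/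
def inducedForm (g : SemiRiemannianMetric I M) (F : C^∞⟮I, M; 𝓘(ℝ, ℝ), ℝ⟯) :
    BilinField I (Hypersurface F) :=
  pullbackBilin (Hypersurface.incl F) (ambientMetric g).form

/-- The coordinate vector field `∂/∂x⁰` on `ℝ × M`. -/
def timeField (q : ℝ × M) : TangentSpace (𝓘(ℝ, ℝ).prod I) q := ((1, 0) : ℝ × E)

/-- The canonical screen distribution of a degenerate Monge-type hypersurface: the tangent vectors
which are orthogonal to `∂/∂x⁰` in the ambient space. -/
def canonicalScreen (g : SemiRiemannianMetric I M) (F : C^∞⟮I, M; 𝓘(ℝ, ℝ), ℝ⟯)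
    (q : Hypersurface F) : Submodule ℝ (TangentSpace I q) :=
  LinearMap.ker (((ambientMetric g).form (Hypersurface.incl F q) (timeField _) ∘L
    mfderiv I (𝓘(ℝ, ℝ).prod I) (Hypersurface.incl F) q : TangentSpace I q →L[ℝ] ℝ) :
      TangentSpace I q →ₗ[ℝ] ℝ)

/-- The distribution `ker dF`. -/
def kerDiff (F : M → ℝ) (x : M) : Submodule ℝ (TangentSpace I x) :=
  LinearMap.ker (mvfderiv I F x : TangentSpace I x →ₗ[ℝ] ℝ)

end Monge

end
end MongeType

open MongeType

/-! Identify the graph with $\widehat M$ through `proj`, whose derivative is the identity of the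
model space. The induced form becomes $g(u,v)=\widehat g(u,v)-dF(u)\,dF(v)$. A radical vector
$u\ne0$ satisfies $\widehat g(u,\cdot)=dF(u)\,dF$, so nondegeneracy of $\widehat g$ forces
$dF(u)\ne0$. Rescaling gives a vector $G$ with $\widehat g(G,\cdot)=dF$ and $dF(G)=1$: degeneracy
yields a gradient of constant square $1$ (`exists_isUnitGradient`). Then the radical is the line
$\mathbb R G$, the canonical screen is $\ker dF$, and the normal space is spanned by $(1,G)$.

Two computations carry the equivalence. For $\xi=a(1,G)$ the second fundamental form is
$B_\xi=-a\,\mathrm{Hess}(F)$ (`secondFundamentalForm_incl`). Differentiating $dF(G)=1$ and $\widehat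
g(G,G)=1$ shows that $\mathrm{Hess}(F)(\cdot,G)=0$ (`hessCoord_gradient`).

The map $u\mapsto u-dF(u)G$ therefore sends every screen isometrically onto $(\ker dF,\widehat g)$
without changing the Hessian. Up to the factor $-a$, the sum in the definition of minimality is the
trace of the Hessian on $\ker dF$, whatever the screen. The trace does not depend on the orthonormal
frame (`IsPseudoOrthonormal.sum_eq_sum`), and smooth orthonormal frames exist locally by an
indefinite Gram–Schmidt process (`exists_orthonormal_fields`), so both conditions say that this
trace vanishes. -/

namespace MongeType

/-! ### Tensor components in the preferred chart -/

section Coordinates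

variable {E : Type*} [NormedAddCommGroup E] [NormedSpace ℝ E]
  {H : Type*} [TopologicalSpace H] {I : ModelWithCorners ℝ E H}
  {M : Type*} [TopologicalSpace M] [ChartedSpace H M]
  {V W : Type*} [NormedAddCommGroup V] [NormedSpace ℝ V] [NormedAddCommGroup W] [NormedSpace ℝ W]

/-- The derivative of a function with values in a normed space, as a linear map on the model space:
its partial derivatives in the preferred chart at `x`. -/
noncomputable def coordDeriv (I : ModelWithCorners ℝ E H) (f : M → V) (x : M) : E →L[ℝ] V :=
  mvfderiv I f x

/-- Leibniz rule for evaluation. The derivatives of $dF(Y)$, $g(G,G)$ and the pairing with a normal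
vector are all instances of it. -/
theorem coordDeriv_clm_apply {A : M → V →L[ℝ] W} {v : M → V} {x : M}
    (hA : MDifferentiableAt I 𝓘(ℝ, V →L[ℝ] W) A x) (hv : MDifferentiableAt I 𝓘(ℝ, V) v x) (u : E) :
    coordDeriv I (fun y ↦ A y (v y)) x u =
      coordDeriv I A x u (v x) + A x (coordDeriv I v x u) := by
  unfold coordDeriv
  rw [(hA.clm_apply hv).mvfderiv, hA.mvfderiv, hv.mvfderiv]
  have h := HasFDerivWithinAt.clm_apply hA.2.hasFDerivWithinAt hv.2.hasFDerivWithinAt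
  have h' := h.fderivWithin (by
    simpa using I.uniqueDiffOn.uniqueDiffWithinAt (mem_range_self _))
  simp only [preimage_univ, univ_inter] at h'
  have := congrArg (fun L : E →L[ℝ] W ↦ L u) h'
  simp [writtenInExtChartAt, Function.comp_def] at this ⊢
  rw [add_comm]
  exact this

theorem coordDeriv_congr {f h : M → V} {x : M} (hfh : f =ᶠ[𝓝 x] h) :
    coordDeriv I f x = coordDeriv I h x := by
  ext u
  exact congrArg (fun L : E →L[ℝ] V ↦ L u) hfh.mfderiv_eq

theorem coordDeriv_const (c : V) (x : M) : coordDeriv I (fun _ : M ↦ c) x = 0 :=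
  mvfderiv_const c

variable [IsManifold I 1 M]

/-- The transition map of a chart with itself is the identity. Hence components at the base point
are the vectors themselves, and model vectors and tangent vectors at $x$ can be exchanged. -/
theorem symmL_trivializationAt_self (x : M) :
    (trivializationAt E (TangentSpace I : M → Type _) x).symmL ℝ x =
      ContinuousLinearMap.id ℝ (TangentSpace I x) := by
  rw [TangentBundle.symmL_trivializationAt_eq_core (mem_chart_source H x)]
  ext v
  exact (tangentBundleCore I M).coordChange_self (achart H x) x (mem_chart_source H x) v

theorem ofCoord_apply (x : M) (v : TangentSpace I x) : ofCoord (I := I) x v = v := by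
  unfold ofCoord
  rw [symmL_trivializationAt_self]; rfl

theorem symmL_coordVec {x y : M}
    (hy : y ∈ (trivializationAt E (TangentSpace I : M → Type _) x).baseSet) (v : TangentSpace I y) :
    (trivializationAt E (TangentSpace I : M → Type _) x).symmL ℝ y (coordVec x ⟨y, v⟩) = v := by
  rw [Trivialization.symmL_apply _ hy]
  exact Trivialization.symm_apply_apply_mk _ hy v

theorem coordVec_self (x : M) (v : TangentSpace I x) : coordVec x ⟨x, v⟩ = v := by
  have := symmL_coordVec (mem_baseSet_trivializationAt E (TangentSpace I : M → Type _) x) v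
  rwa [symmL_trivializationAt_self] at this

theorem coordBilin_coordVec (b : BilinField I M) {x y : M}
    (hy : y ∈ (trivializationAt E (TangentSpace I : M → Type _) x).baseSet)
    (v w : TangentSpace I y) :
    coordBilin b x y (coordVec x ⟨y, v⟩) (coordVec x ⟨y, w⟩) = b y v w := by
  simp only [coordBilin, compBilin_apply, symmL_coordVec hy]

theorem coordBilin_self (b : BilinField I M) (x : M) (v w : TangentSpace I x) :
    coordBilin b x x v w = b x v w := by
  simp only [coordBilin, symmL_trivializationAt_self]; rfl

theorem eventually_mem_baseSet (x : M) :
    ∀ᶠ y in 𝓝 x, y ∈ (trivializationAt E (TangentSpace I : M → Type _) x).baseSet :=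
  (trivializationAt E (TangentSpace I) x).open_baseSet.mem_nhds
    (mem_baseSet_trivializationAt E (TangentSpace I) x)

/-- The differential `dF` at `y` read in the preferred chart at `x`. -/
noncomputable def coordDiff (I : ModelWithCorners ℝ E H) [IsManifold I 1 M] (F : M → ℝ) (x y : M) :
    E →L[ℝ] ℝ :=
  mvfderiv I F y ∘L (trivializationAt E (TangentSpace I : M → Type _) x).symmL ℝ y

theorem coordDiff_coordVec (F : M → ℝ) {x y : M}
    (hy : y ∈ (trivializationAt E (TangentSpace I : M → Type _) x).baseSet)
    (v : TangentSpace I y) :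
    coordDiff I F x y (coordVec x ⟨y, v⟩) = mvfderiv I F y v := by
  unfold coordDiff
  rw [ContinuousLinearMap.comp_apply, symmL_coordVec hy]

theorem coordDiff_self (F : M → ℝ) (x : M) (v : TangentSpace I x) :
    coordDiff I F x x v = mvfderiv I F x v := by
  unfold coordDiff
  rw [symmL_trivializationAt_self]; rfl

theorem partialBilin_eq_coordDeriv (b : BilinField I M) (x : M) :
    partialBilin b x = coordDeriv I (coordBilin b x) x := by
  ext1 u
  exact congrArg (mvfderiv I (coordBilin b x) x) (ofCoord_apply x u)

/-- The Christoffel symbols of the first kind. -/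
noncomputable def koszul (b : BilinField I M) (x : M) (u v w : E) : ℝ :=
  (1 / 2 : ℝ) * (partialBilin b x u v w + partialBilin b x v u w - partialBilin b x w u v)

/-- Lowering the index. A nondegenerate form is an injective map from $E$ to its dual, hence
invertible by equality of dimensions, so the inverse in `christoffel` is not a junk value. -/
theorem coordBilin_christoffel [FiniteDimensional ℝ E] {b : BilinField I M} {x : M}
    (hb : ∀ v : TangentSpace I x, (∀ w, b x v w = 0) → v = 0) (u v w : E) :
    coordBilin b x x (christoffel b x u v) w = koszul b x u v w := by
  have hinj : Function.Injective (coordBilin b x x) := by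
    rw [injective_iff_map_eq_zero]
    intro a ha
    refine hb a fun c ↦ ?_
    exact (coordBilin_self b x a c).symm.trans (congrArg (fun L : E →L[ℝ] ℝ ↦ L c) ha)
  have hinv : (coordBilin b x x).IsInvertible := by
    refine ⟨(LinearEquiv.ofInjectiveOfFinrankEq (coordBilin b x x : E →ₗ[ℝ] E →L[ℝ] ℝ) hinj
      (by rw [← (LinearMap.toContinuousLinearMap : (E →ₗ[ℝ] ℝ) ≃ₗ[ℝ] _).finrank_eq]
          exact (Subspace.dual_finrank_eq (K := ℝ) (V := E)).symm)).toContinuousLinearEquiv, ?_⟩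
    ext a c; rfl
  obtain ⟨e, he⟩ := hinv
  unfold christoffel koszul
  rw [← he, ContinuousLinearMap.inverse_equiv]
  simp

end Coordinates

/-! ### Differentiability of components and symmetry of second derivatives -/

section Smooth

variable {E : Type*} [NormedAddCommGroup E] [NormedSpace ℝ E]
  {H : Type*} [TopologicalSpace H] {I : ModelWithCorners ℝ E H}
  {M : Type*} [TopologicalSpace M] [ChartedSpace H M] [IsManifold I ∞ M]
  {EN : Type*} [NormedAddCommGroup EN] [NormedSpace ℝ EN]
  {HN : Type*} [TopologicalSpace HN] {J : ModelWithCorners ℝ EN HN}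
  {N : Type*} [TopologicalSpace N] [ChartedSpace HN N]

theorem IsSmoothBilin.mdifferentiableAt_coordBilin {b : BilinField I M} (hb : IsSmoothBilin b)
    (x : M) : MDifferentiableAt I 𝓘(ℝ, E →L[ℝ] E →L[ℝ] ℝ) (coordBilin b x) x :=
  ((isSmoothBilin_iff b).1 hb x).mdifferentiableAt (by simp)

theorem IsSmoothAlongOn.mdifferentiableAt_coordVec {f : N → M} {Z : Π y : N, TangentSpace I (f y)}
    {U : Set N} (hZ : IsSmoothAlongOn J f Z U) {x : N} (hU : U ∈ 𝓝 x) :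
    MDifferentiableAt J 𝓘(ℝ, E) (fun z ↦ coordVec (f x) ⟨f z, Z z⟩) x := by
  have h := (hZ.contMDiffAt hU)
  rw [contMDiffAt_totalSpace] at h
  exact h.2.mdifferentiableAt (by simp)

theorem IsSmoothBilin.partialBilin_apply {b : BilinField I M} (hb : IsSmoothBilin b) (x : M)
    (u v w : E) : partialBilin b x u v w = coordDeriv I (fun y ↦ coordBilin b x y v w) x u := by
  have hd := hb.mdifferentiableAt_coordBilin x
  rw [coordDeriv_clm_apply (hd.clm_apply mdifferentiableAt_const) mdifferentiableAt_const,
    coordDeriv_clm_apply hd mdifferentiableAt_const, partialBilin_eq_coordDeriv]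
  simp [coordDeriv_const]

theorem partialBilin_symm {b : BilinField I M} (hb : IsSmoothBilin b)
    (hs : ∀ (x : M) (v w : TangentSpace I x), b x v w = b x w v) (x : M) (u v w : E) :
    partialBilin b x u v w = partialBilin b x u w v := by
  rw [hb.partialBilin_apply, hb.partialBilin_apply]
  congr 2
  funext y
  exact hs _ _ _

/-- Chain rule through the inverse chart. It reduces the regularity of $dF$ and the equality of
mixed partials to ordinary calculus on the model space. -/
theorem coordDiff_eventuallyEq [I.Boundaryless] {F : M → ℝ} (hF : ContMDiff I 𝓘(ℝ, ℝ) ∞ F)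
    (x : M) :
    coordDiff I F x =ᶠ[𝓝 x]
      fun y ↦ fderiv ℝ (F ∘ (extChartAt I x).symm) (extChartAt I x y) := by
  filter_upwards [chart_source_mem_nhds H x] with y hy
  unfold coordDiff
  rw [TangentBundle.symmL_trivializationAt hy]
  have hy' : y ∈ (extChartAt I x).source := by rwa [extChartAt_source]
  have h1 : MDifferentiableAt I 𝓘(ℝ, ℝ) F ((extChartAt I x).symm (extChartAt I x y)) :=
    hF.mdifferentiableAt (by simp)
  have h2 := mfderiv_comp_mfderivWithin (I := 𝓘(ℝ, E)) (s := range I) (extChartAt I x y) h1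
    (mdifferentiableWithinAt_extChartAt_symm ((extChartAt I x).map_source hy')) (by
      simpa [I.range_eq_univ] using uniqueMDiffWithinAt_univ 𝓘(ℝ, E))
  rw [I.range_eq_univ, mfderivWithin_univ, mfderiv_eq_fderiv] at h2
  rw [I.range_eq_univ, h2]
  rw [(extChartAt I x).left_inv hy']
  rfl

omit [IsManifold I ∞ M] in
theorem contDiffAt_comp_extChartAt_symm [I.Boundaryless] {F : M → ℝ}
    (hF : ContMDiff I 𝓘(ℝ, ℝ) ∞ F) (x : M) :
    ContDiffAt ℝ ∞ (F ∘ (extChartAt I x).symm) (extChartAt I x x) := by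
  have := (contMDiffAt_iff.1 (hF x)).2
  rw [I.range_eq_univ, contDiffWithinAt_univ] at this
  exact this

theorem mdifferentiableAt_coordDiff [I.Boundaryless] {F : M → ℝ} (hF : ContMDiff I 𝓘(ℝ, ℝ) ∞ F)
    (x : M) : MDifferentiableAt I 𝓘(ℝ, E →L[ℝ] ℝ) (coordDiff I F x) x := by
  have h1 : DifferentiableAt ℝ (fderiv ℝ (F ∘ (extChartAt I x).symm)) (extChartAt I x x) :=
    ((contDiffAt_comp_extChartAt_symm hF x).fderiv_right (m := 1) (by norm_cast)).differentiableAt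
      (by simp)
  exact (h1.mdifferentiableAt.comp x
    (mdifferentiableAt_extChartAt (mem_chart_source H x))).congr_of_eventuallyEq
      (coordDiff_eventuallyEq hF x)

theorem coordDeriv_coordDiff_symm [I.Boundaryless] {F : M → ℝ} (hF : ContMDiff I 𝓘(ℝ, ℝ) ∞ F)
    (x : M) (u v : E) :
    coordDeriv I (coordDiff I F x) x u v = coordDeriv I (coordDiff I F x) x v u := by
  have hd := mdifferentiableAt_coordDiff hF x
  have h1 := contDiffAt_comp_extChartAt_symm hF x
  have h2 : coordDeriv I (coordDiff I F x) x =
      fderiv ℝ (fderiv ℝ (F ∘ (extChartAt I x).symm)) (extChartAt I x x) := by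
    unfold coordDeriv
    rw [hd.mvfderiv, I.range_eq_univ, fderivWithin_univ]
    refine Filter.EventuallyEq.fderiv_eq ?_
    have := (continuousAt_extChartAt_symm (I := I) x).eventually
      (p := fun y ↦ coordDiff I F x y = fderiv ℝ (F ∘ (extChartAt I x).symm) (extChartAt I x y))
      (by rw [extChartAt_to_inv]; exact coordDiff_eventuallyEq hF x)
    filter_upwards [this, extChartAt_target_mem_nhds (I := I) x] with z hz hz'
    simp only [writtenInExtChartAt, extChartAt_model_space_eq_id, PartialEquiv.refl_coe,
      Function.comp_apply, id]
    rw [hz, (extChartAt I x).right_inv hz']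
  have h3 := h1.isSymmSndFDerivAt (by simp [minSmoothness_of_isRCLikeNormedField]; norm_cast) u v
  rw [h2]
  exact h3

end Smooth

/-! ### The Hessian in coordinates and its kernel -/

section Hessian

variable {E : Type*} [NormedAddCommGroup E] [NormedSpace ℝ E]
  {H : Type*} [TopologicalSpace H] {I : ModelWithCorners ℝ E H}
  {M : Type*} [TopologicalSpace M] [ChartedSpace H M]

/-- The Hessian of `F` at `x` read in the preferred chart at `x`, where `G` is the gradient of `F`
at `x`. -/
noncomputable def hessCoord [IsManifold I 1 M] (b : BilinField I M) (F : M → ℝ) (x : M) (G : E) :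
    E →L[ℝ] E →L[ℝ] ℝ :=
  let K : E →L[ℝ] E →L[ℝ] ℝ :=
    ContinuousLinearMap.compL ℝ E (E →L[ℝ] ℝ) ℝ (ContinuousLinearMap.apply ℝ ℝ G) ∘L
      partialBilin b x
  coordDeriv I (coordDiff I F x) x - (1 / 2 : ℝ) • (K + K.flip - partialBilin b x G)

theorem hessCoord_apply [IsManifold I 1 M] (b : BilinField I M) (F : M → ℝ) (x : M) (G u v : E) :
    hessCoord b F x G u v = coordDeriv I (coordDiff I F x) x u v - koszul b x u v G := rfl

theorem hessCoord_add_smul [IsManifold I 1 M] (b : BilinField I M) (F : M → ℝ) (x : M)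
    (G u v : E) (c d : ℝ) (h : ∀ w, hessCoord b F x G w G = 0)
    (h' : ∀ w, hessCoord b F x G G w = 0) :
    hessCoord b F x G (u + c • G) (v + d • G) = hessCoord b F x G u v := by
  simp [h, h']

variable [IsManifold I ∞ M]

/-- In $X(YF)-(\nabla_XY)F$ the terms containing derivatives of the components of $Y$ cancel. The
remaining term $dF(\Gamma(X,Y))$ equals $g(\Gamma(X,Y),G)$, a symbol of the first kind. Thus the
Hessian is tensorial and depends only on values at $x$. -/
theorem hess_eq_hessCoord [FiniteDimensional ℝ E] [I.Boundaryless] (g : SemiRiemannianMetric I M)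
    {F : M → ℝ} (hF : ContMDiff I 𝓘(ℝ, ℝ) ∞ F) {x : M} {G : TangentSpace I x}
    (hG : ∀ v, g.form x G v = mvfderiv I F x v) (X : Π x : M, TangentSpace I x)
    {Y : Π x : M, TangentSpace I x} {U : Set M} (hU : U ∈ 𝓝 x) (hY : IsSmoothAlongOn I id Y U) :
    hess g.form F X Y x = hessCoord g.form F x G (X x) (Y x) := by
  -- The components of $Y$, and below $X(x)$ and $G$, get opaque names typed in the model space, so
  -- that rewriting need not unfold tangent spaces.
  obtain ⟨c, hc⟩ : ∃ c : M → E, c = fun y ↦ coordVec x ⟨y, Y y⟩ := ⟨_, rfl⟩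
  have hcd : MDifferentiableAt I 𝓘(ℝ, E) c x := hc ▸ hY.mdifferentiableAt_coordVec hU
  have hcx : c x = Y x := hc ▸ coordVec_self x (Y x)
  obtain ⟨u, hu⟩ : ∃ u : E, u = X x := ⟨_, rfl⟩
  obtain ⟨G', rfl⟩ : ∃ G' : E, G' = G := ⟨_, rfl⟩
  have h1 : (fun y ↦ mvfderiv I F y (Y y)) =ᶠ[𝓝 x] fun y ↦ coordDiff I F x y (c y) := by
    filter_upwards [eventually_mem_baseSet (I := I) x] with y hy
    exact (congrArg _ (congrFun hc y)).trans (coordDiff_coordVec F hy (Y y)) |>.symm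
  have h2 : hess g.form F X Y x = coordDeriv I (fun y ↦ mvfderiv I F y (Y y)) x u -
      coordDiff I F x x (coordDeriv I c x u + christoffel g.form x u (c x)) := by
    have h4 : coordVec x (⟨x, mfderiv I I (id : M → M) x (X x)⟩ : TangentBundle I M) = X x :=
      (coordVec_self x _).trans (by rw [mfderiv_id]; rfl)
    have h5 : leviCivita g.form X Y x =
        ofCoord x (coordDeriv I c x u + christoffel g.form x u (c x)) := by
      have h6 : leviCivita g.form X Y x = ofCoord x (coordDeriv I c x u + christoffel g.form x
          (coordVec x (⟨x, mfderiv I I (id : M → M) x (X x)⟩ : TangentBundle I M)) (c x)) := by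
        rw [hc, hu]; rfl
      rw [h6, h4, hu]
    unfold hess
    rw [h5, hu]
    rfl
  have h3 : coordDiff I F x x (christoffel g.form x u (c x)) = koszul g.form x u (c x) G' := by
    rw [← coordBilin_christoffel (g.nondegenerate x)]
    refine (coordDiff_self F x _).trans ((hG _).symm.trans ?_)
    exact (g.symm _ _ _).trans (coordBilin_self g.form x _ _).symm
  have h4 : hess g.form F X Y x = hessCoord g.form F x G' u (c x) := by
    rw [h2, coordDeriv_congr h1, coordDeriv_clm_apply (mdifferentiableAt_coordDiff hF x) hcd,
      map_add, h3, hessCoord_apply]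
    ring
  rw [h4, hu, hcx]

theorem hessCoord_symm [I.Boundaryless] (g : SemiRiemannianMetric I M) {F : M → ℝ}
    (hF : ContMDiff I 𝓘(ℝ, ℝ) ∞ F) (x : M) (G u v : E) :
    hessCoord g.form F x G u v = hessCoord g.form F x G v u := by
  rw [hessCoord_apply, hessCoord_apply]
  unfold koszul
  rw [coordDeriv_coordDiff_symm hF, partialBilin_symm g.smooth g.symm x G u v]
  ring

/-- A gradient of constant square is geodesic. The derivative of $dF(G)=1$ gives
$\partial_u(dF)(G)=-dF(\partial_uG)$, that of $g(G,G)=1$ gives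
$\tfrac12\,\partial_ug(G,G)=-dF(\partial_uG)$, and `koszul` at $(u,G,G)$ collapses to
$\tfrac12\,\partial_ug(G,G)$. The two terms of the Hessian cancel. -/
theorem hessCoord_gradient [I.Boundaryless] (g : SemiRiemannianMetric I M) {F : M → ℝ}
    (hF : ContMDiff I 𝓘(ℝ, ℝ) ∞ F) {x : M} {G : Π y : M, TangentSpace I y} {U : Set M}
    (hU : U ∈ 𝓝 x) (hGs : IsSmoothAlongOn I id G U)
    (hG : ∀ y ∈ U, ∀ v, g.form y (G y) v = mvfderiv I F y v)
    (hG1 : ∀ y ∈ U, mvfderiv I F y (G y) = 1) (u : E) :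
    hessCoord g.form F x (G x) u (G x) = 0 := by
  obtain ⟨c, hc⟩ : ∃ c : M → E, c = fun y ↦ coordVec x ⟨y, G y⟩ := ⟨_, rfl⟩
  have hcd : MDifferentiableAt I 𝓘(ℝ, E) c x := hc ▸ hGs.mdifferentiableAt_coordVec hU
  have hcx : c x = G x := hc ▸ coordVec_self x (G x)
  have hd := mdifferentiableAt_coordDiff hF x
  have hb := g.smooth.mdifferentiableAt_coordBilin x
  have h1 : (fun y ↦ coordDiff I F x y (c y)) =ᶠ[𝓝 x] fun _ ↦ (1 : ℝ) := by
    filter_upwards [eventually_mem_baseSet (I := I) x, hU] with y hy hyU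
    exact (congrArg _ (congrFun hc y)).trans ((coordDiff_coordVec F hy (G y)).trans (hG1 y hyU))
  have h2 : (fun y ↦ coordBilin g.form x y (c y) (c y)) =ᶠ[𝓝 x] fun _ ↦ (1 : ℝ) := by
    filter_upwards [eventually_mem_baseSet (I := I) x, hU] with y hy hyU
    rw [hc]
    exact (coordBilin_coordVec g.form hy (G y) (G y)).trans ((hG y hyU _).trans (hG1 y hyU))
  have k1 := coordDeriv_clm_apply hd hcd u
  rw [coordDeriv_congr h1, coordDeriv_const] at k1
  have k2 := coordDeriv_clm_apply (hb.clm_apply hcd) hcd u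
  rw [coordDeriv_congr h2, coordDeriv_const, coordDeriv_clm_apply hb hcd u,
    ← partialBilin_eq_coordDeriv] at k2
  have k3 : ∀ D : E, coordBilin g.form x x (c x) D = coordDiff I F x x D := fun D ↦ by
    rw [hcx]
    exact (coordBilin_self g.form x _ _).trans
      ((hG x (mem_of_mem_nhds hU) _).trans (coordDiff_self F x _).symm)
  have k4 : ∀ D : E, coordBilin g.form x x D (c x) = coordDiff I F x x D := fun D ↦ by
    rw [← k3]
    exact g.symm _ _ _
  have k5 : hessCoord g.form F x (c x) u (c x) = 0 := by
    rw [hessCoord_apply]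
    unfold koszul
    rw [add_apply, k3, k4] at k2
    simp only [zero_apply] at k1 k2
    linarith
  rwa [hcx] at k5

end Hessian

theorem coordDeriv_smul_const_sub {E : Type*} [NormedAddCommGroup E] [NormedSpace ℝ E]
    {H : Type*} [TopologicalSpace H] {I : ModelWithCorners ℝ E H}
    {M : Type*} [TopologicalSpace M] [ChartedSpace H M]
    {V : Type*} [NormedAddCommGroup V] [NormedSpace ℝ V] {f : M → V} {x : M} (c : V) (a : ℝ)
    (hf : MDifferentiableAt I 𝓘(ℝ, V) f x) (u : E) :
    coordDeriv I (fun y ↦ a • (c - f y)) x u = -(a • coordDeriv I f x u) := by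
  have h1 : coordDeriv I (fun y ↦ c - f y) x = -coordDeriv I f x := by
    have h2 := mvfderiv_sub (mdifferentiableAt_const (c := c)) hf
    rw [mvfderiv_const, zero_sub] at h2
    exact h2
  have h2 := coordDeriv_clm_apply
    (mdifferentiableAt_const (c := a • ContinuousLinearMap.id ℝ V))
    ((mdifferentiableAt_const (c := c)).sub hf) u
  rw [coordDeriv_const, zero_apply, zero_apply, zero_add] at h2
  refine h2.trans ((congrArg (fun T : E →L[ℝ] V ↦ a • T u) h1).trans ?_)
  simp

theorem koszul_smul {E : Type*} [NormedAddCommGroup E] [NormedSpace ℝ E]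
    {H : Type*} [TopologicalSpace H] {I : ModelWithCorners ℝ E H}
    {M : Type*} [TopologicalSpace M] [ChartedSpace H M] [IsManifold I 1 M]
    (b : BilinField I M) (x : M) (u v w : E) (a : ℝ) :
    koszul b x u v (a • w) = a * koszul b x u v w := by
  unfold koszul
  rw [(partialBilin b x u v).map_smul, (partialBilin b x v u).map_smul,
    (partialBilin b x).map_smul, smul_apply, smul_apply]
  simp only [smul_eq_mul]
  ring

/-! ### The graph as a copy of the base, and product coordinates -/

section Ambient

variable {E : Type*} [NormedAddCommGroup E] [NormedSpace ℝ E]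
  {H : Type*} [TopologicalSpace H] {I : ModelWithCorners ℝ E H}
  {M : Type*} [TopologicalSpace M] [ChartedSpace H M]

namespace Hypersurface

variable (F : C^∞⟮I, M; 𝓘(ℝ, ℝ), ℝ⟯)

/-- The charts of the graph are those of the base composed with `proj`, so `proj` reads as the
identity. Its derivative is then the identity, and vector fields pass between graph and base with
unchanged values. -/
theorem writtenInExtChartAt_proj (q : Hypersurface F) :
    EqOn (writtenInExtChartAt I I q (proj F)) id (extChartAt I q).target := by
  intro z hz
  exact (extChartAt I (proj F q)).right_inv hz

theorem writtenInExtChartAt_proj_symm (p : M) :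
    EqOn (writtenInExtChartAt I I p (proj F).symm) id (extChartAt I p).target := by
  intro z hz
  exact (extChartAt I p).right_inv hz

theorem contMDiff_proj : ContMDiff I I ∞ (proj F) := by
  intro q
  rw [contMDiffAt_iff]
  refine ⟨(proj F).continuous.continuousAt, ?_⟩
  exact contDiffWithinAt_id.congr_of_eventuallyEq
    (Filter.eventuallyEq_of_mem (extChartAt_target_mem_nhdsWithin q) (writtenInExtChartAt_proj F q))
    (writtenInExtChartAt_proj F q (mem_extChartAt_target q))

theorem contMDiff_proj_symm : ContMDiff I I ∞ (proj F).symm := by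
  intro q
  rw [contMDiffAt_iff]
  refine ⟨(proj F).symm.continuous.continuousAt, ?_⟩
  exact contDiffWithinAt_id.congr_of_eventuallyEq
    (Filter.eventuallyEq_of_mem (extChartAt_target_mem_nhdsWithin q)
      (writtenInExtChartAt_proj_symm F q))
    (writtenInExtChartAt_proj_symm F q (mem_extChartAt_target q))

theorem mfderiv_proj (q : Hypersurface F) :
    mfderiv I I (proj F) q = ContinuousLinearMap.id ℝ E := by
  refine HasMFDerivAt.mfderiv ⟨(proj F).continuous.continuousAt, ?_⟩
  exact (hasFDerivWithinAt_id _ _).congr_of_eventuallyEq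
    (Filter.eventuallyEq_of_mem (extChartAt_target_mem_nhdsWithin q) (writtenInExtChartAt_proj F q))
    (writtenInExtChartAt_proj F q (mem_extChartAt_target q))

theorem mfderiv_proj_symm (p : M) :
    mfderiv I I (proj F).symm p = ContinuousLinearMap.id ℝ E := by
  refine HasMFDerivAt.mfderiv ⟨(proj F).symm.continuous.continuousAt, ?_⟩
  exact (hasFDerivWithinAt_id _ _).congr_of_eventuallyEq
    (Filter.eventuallyEq_of_mem (extChartAt_target_mem_nhdsWithin p)
      (writtenInExtChartAt_proj_symm F p))
    (writtenInExtChartAt_proj_symm F p (mem_extChartAt_target p))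

theorem incl_eq : incl F = (fun p ↦ (F p, p)) ∘ proj F := by
  funext q
  exact Prod.ext q.2 rfl

theorem contMDiff_incl : ContMDiff I (𝓘(ℝ, ℝ).prod I) ∞ (incl F) := by
  rw [incl_eq]
  exact (F.contMDiff.prodMk contMDiff_id).comp (contMDiff_proj F)

theorem mfderiv_incl (q : Hypersurface F) (v : E) :
    mfderiv I (𝓘(ℝ, ℝ).prod I) (incl F) q v = ((mvfderiv I F (proj F q) v, v) : ℝ × E) := by
  have h1 : MDifferentiableAt I 𝓘(ℝ, ℝ) F (proj F q) := F.mdifferentiableAt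
  have h2 : MDifferentiableAt I I (fun p : M ↦ p) (proj F q) := mdifferentiableAt_id
  have h3 : MDifferentiableAt I I (proj F) q := (contMDiff_proj F).mdifferentiableAt (by simp)
  rw [incl_eq, mfderiv_comp q (h1.prodMk h2) h3, mfderiv_proj, h1.mfderiv_prod h2]
  have : mfderiv I I (fun p : M ↦ p) (proj F q) = ContinuousLinearMap.id ℝ _ := mfderiv_id
  rw [this]
  rfl

theorem mfderiv_incl_proj_symm [IsManifold I 1 M] (p : M) (v : E) :
    mfderiv I (𝓘(ℝ, ℝ).prod I) (incl F) ((proj F).symm p) v =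
      ((coordDiff I F p p v, v) : ℝ × E) :=
  (mfderiv_incl F _ v).trans (congrArg (fun t : ℝ ↦ ((t, v) : ℝ × E)) (coordDiff_self F p v).symm)

theorem isSmoothAlongOn_comp_proj_symm [IsManifold I ∞ M] {Y : Π q : Hypersurface F, TangentSpace I q}
    {U : Set (Hypersurface F)} (hY : IsSmoothAlongOn I id Y U) :
    IsSmoothAlongOn (I := I) I (id : M → M) (fun x ↦ Y ((proj F).symm x)) ((proj F).symm ⁻¹' U) := by
  have h := ((contMDiff_proj F).contMDiff_tangentMap (m := ∞) (by simp)).comp_contMDiffOn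
    (hY.comp (contMDiff_proj_symm F).contMDiffOn (s := (proj F).symm ⁻¹' U) subset_rfl)
  refine h.congr fun x _ ↦ ?_
  refine (congrArg (fun v : E ↦ (⟨x, v⟩ : TangentBundle I M)) ?_).symm
  exact congrArg (fun L : E →L[ℝ] E ↦ L (Y ((proj F).symm x))) (mfderiv_proj F _)

theorem isSmoothAlongOn_comp_proj [IsManifold I ∞ M] {Z : Π p : M, TangentSpace I p}
    {V : Set M} (hZ : IsSmoothAlongOn I id Z V) :
    IsSmoothAlongOn (I := I) I (id : Hypersurface F → Hypersurface F) (fun q ↦ Z (proj F q))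
      (proj F ⁻¹' V) := by
  have h := ((contMDiff_proj_symm F).contMDiff_tangentMap (m := ∞) (by simp)).comp_contMDiffOn
    (hZ.comp (contMDiff_proj F).contMDiffOn (s := proj F ⁻¹' V) subset_rfl)
  refine h.congr fun q _ ↦ ?_
  obtain ⟨p, rfl⟩ := (proj F).symm.surjective q
  refine (congrArg (fun v : E ↦ (⟨(proj F).symm p, v⟩ : TangentBundle I (Hypersurface F))) ?_).symm
  exact congrArg (fun L : E →L[ℝ] E ↦ L (Z p)) (mfderiv_proj_symm F _)

theorem coordDeriv_eq_comp_proj_symm {V : Type*} [NormedAddCommGroup V] [NormedSpace ℝ V]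
    {h : Hypersurface F → V} {p : M} (hh : MDifferentiableAt I 𝓘(ℝ, V) h ((proj F).symm p)) :
    coordDeriv I h ((proj F).symm p) = coordDeriv I (fun x ↦ h ((proj F).symm x)) p := by
  have h3 : MDifferentiableAt I I (proj F).symm p :=
    (contMDiff_proj_symm F).mdifferentiableAt (by simp)
  have := mfderiv_comp p hh h3
  rw [mfderiv_proj_symm] at this
  ext u
  exact (congrArg (fun L : E →L[ℝ] V ↦ L u) this).symm

end Hypersurface

variable [IsManifold I 1 M]

theorem coordVec_eq_mfderiv (x y : M) (hy : y ∈ (chartAt H x).source) (v : TangentSpace I y) :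
    coordVec x ⟨y, v⟩ = mfderiv I 𝓘(ℝ, E) (extChartAt I x) y v := by
  have h1 : (trivializationAt E (TangentSpace I : M → Type _) x).continuousLinearMapAt ℝ y v =
      coordVec x ⟨y, v⟩ := by
    rw [Trivialization.continuousLinearMapAt_apply, Trivialization.coe_linearMapAt_of_mem _ hy]
    rfl
  exact h1.symm.trans (congrArg (fun L : E →L[ℝ] E ↦ L v)
    (TangentBundle.continuousLinearMapAt_trivializationAt hy))

theorem coordVec_prod (q y : ℝ × M) (hy : y.2 ∈ (chartAt H q.2).source) (a : ℝ) (v : E) :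
    coordVec (I := 𝓘(ℝ, ℝ).prod I) q ⟨y, ((a, v) : ℝ × E)⟩ =
      (a, coordVec (I := I) q.2 ⟨y.2, v⟩) := by
  have hy' : y ∈ (chartAt (ModelProd ℝ H) q).source := ⟨mem_univ _, hy⟩
  have h1 : MDifferentiableAt 𝓘(ℝ, ℝ) 𝓘(ℝ, ℝ) (fun t : ℝ ↦ t) y.1 := mdifferentiableAt_id
  have h2 : MDifferentiableAt I 𝓘(ℝ, E) (extChartAt I q.2) y.2 := mdifferentiableAt_extChartAt hy
  have h3 : (extChartAt (𝓘(ℝ, ℝ).prod I) q : ℝ × M → ℝ × E) =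
      Prod.map (fun t : ℝ ↦ t) (extChartAt I q.2) := by
    funext z
    simp
    rfl
  have h4 := mfderiv_prodMap h1 h2
  have h5 : mfderiv 𝓘(ℝ, ℝ) 𝓘(ℝ, ℝ) (fun t : ℝ ↦ t) y.1 = ContinuousLinearMap.id ℝ _ := mfderiv_id
  refine (coordVec_eq_mfderiv q y hy' _).trans ?_
  rw [h3]
  -- The derivative of the product chart lands in $\mathbb R\times E$ with its own model, while the
  -- product rule uses the product of the two models.
  rw [modelWithCornersSelf_prod, ← chartedSpaceSelf_prod]
  rw [h5] at h4
  refine (congrArg (fun L : ℝ × E →L[ℝ] ℝ × E ↦ L (a, v)) h4).trans ?_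
  exact Prod.ext rfl (coordVec_eq_mfderiv q.2 y.2 hy v).symm

theorem coordBilin_ambientForm (b : BilinField I M) (q y : ℝ × M)
    (hy : y.2 ∈ (chartAt H q.2).source) (v w : ℝ × E) :
    coordBilin (ambientForm b) q y v w = -(v.1 * w.1) + coordBilin b q.2 y.2 v.2 w.2 := by
  -- Every model vector is the component vector of an actual tangent vector at $y$, so the forms may
  -- be compared on tangent vectors, where `ambientForm_apply` is available.
  have key : ∀ v : ℝ × E, ∃ a : E, v = coordVec (I := 𝓘(ℝ, ℝ).prod I) q ⟨y, ((v.1, a) : ℝ × E)⟩ ∧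
      v.2 = coordVec (I := I) q.2 ⟨y.2, a⟩ := by
    intro v
    refine ⟨(trivializationAt E (TangentSpace I : M → Type _) q.2).symmL ℝ y.2 v.2, ?_⟩
    have : v.2 = coordVec (I := I) q.2 ⟨y.2,
        (trivializationAt E (TangentSpace I : M → Type _) q.2).symmL ℝ y.2 v.2⟩ := by
      have h := (trivializationAt E (TangentSpace I : M → Type _) q.2).apply_mk_symm
        (b := y.2) hy v.2
      rw [Trivialization.symmL_apply _ hy]
      exact (congrArg Prod.snd h).symm
    refine ⟨?_, this⟩
    refine Eq.trans ?_ (coordVec_prod q y hy _ _).symm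
    exact Prod.ext rfl this
  obtain ⟨a, ha, ha'⟩ := key v
  obtain ⟨c, hc, hc'⟩ := key w
  have hy' : y ∈ (trivializationAt (ℝ × E) (TangentSpace (𝓘(ℝ, ℝ).prod I) : ℝ × M → Type _)
    q).baseSet := by
    have : y ∈ (chartAt (ModelProd ℝ H) q).source := ⟨mem_univ _, hy⟩
    exact this
  have h1 := coordBilin_coordVec (ambientForm b) hy' ((v.1, a) : ℝ × E) ((w.1, c) : ℝ × E)
  rw [← ha, ← hc] at h1
  have h2 := coordBilin_coordVec (x := q.2) b hy a c
  rw [← ha', ← hc'] at h2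
  rw [h1, h2]
  exact ambientForm_apply b y _ _

end Ambient

/-! ### The second fundamental form of the graph -/

section SecondFundamentalForm

variable {E : Type*} [NormedAddCommGroup E] [NormedSpace ℝ E]
  {H : Type*} [TopologicalSpace H] {I : ModelWithCorners ℝ E H}
  {M : Type*} [TopologicalSpace M] [ChartedSpace H M] [IsManifold I ∞ M]

/-- The coefficient of $dx^0\otimes dx^0$ is constant and the other coefficients do not depend on
$t$: the ambient first-kind symbols are those of the base. -/
theorem partialBilin_ambientForm {b : BilinField I M} (hb : IsSmoothBilin b) (q : ℝ × M)
    (u v w : ℝ × E) : partialBilin (ambientForm b) q u v w = partialBilin b q.2 u.2 v.2 w.2 := by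
  rw [(isSmoothBilin_ambientForm hb).partialBilin_apply, hb.partialBilin_apply]
  have h1 : (fun y ↦ coordBilin (ambientForm b) q y v w) =ᶠ[𝓝 q]
      fun y ↦ (fun (_ : ℝ) (p : M) ↦ -(v.1 * w.1) + coordBilin b q.2 p v.2 w.2) y.1 y.2 := by
    filter_upwards [continuous_snd.continuousAt (x := q) (chart_source_mem_nhds H q.2)] with y hy
    exact coordBilin_ambientForm b q y hy v w
  rw [coordDeriv_congr h1]
  have hd : MDifferentiableAt I 𝓘(ℝ, ℝ) (fun p ↦ coordBilin b q.2 p v.2 w.2) q.2 :=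
    ((hb.mdifferentiableAt_coordBilin q.2).clm_apply mdifferentiableAt_const).clm_apply
      mdifferentiableAt_const
  have h2 : MDifferentiableAt I 𝓘(ℝ, ℝ) (fun p ↦ -(v.1 * w.1) + coordBilin b q.2 p v.2 w.2) q.2 :=
    mdifferentiableAt_const.add hd
  have h3 := mfderiv_comp q h2 (mdifferentiableAt_snd (I := 𝓘(ℝ, ℝ)) (I' := I) (M := ℝ) (M' := M))
  rw [mfderiv_snd] at h3
  have h4 := mvfderiv_add (I := I) (mdifferentiableAt_const (c := -(v.1 * w.1))) hd
  rw [mvfderiv_const, zero_add] at h4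
  refine (congrArg (fun L : ℝ × E →L[ℝ] ℝ ↦ L u) h3).trans ?_
  exact congrArg (fun L : E →L[ℝ] ℝ ↦ L u.2) h4

variable {EN : Type*} [NormedAddCommGroup EN] [NormedSpace ℝ EN]
  {HN : Type*} [TopologicalSpace HN] {J : ModelWithCorners ℝ EN HN}
  {N : Type*} [TopologicalSpace N] [ChartedSpace HN N]

/-- Pairing with $\xi$ lowers the index of the Christoffel term, so the ambient metric never has to
be inverted. -/
theorem secondFundamentalForm_eq [FiniteDimensional ℝ E] (g : SemiRiemannianMetric I M) (f : N → M)
    (ξ : Π y : N, TangentSpace I (f y)) (X Y : Π y : N, TangentSpace J y) (y : N)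
    {u v w : E} (hu : u = mfderiv J I f y (X y)) (hv : v = mfderiv J I f y (Y y)) (hw : w = ξ y)
    {D : EN} (hD : D = X y) :
    secondFundamentalForm g.form f ξ X Y y = coordBilin g.form (f y) (f y)
      (coordDeriv J (fun z ↦ coordVec (f y) ⟨f z, mfderiv J I f z (Y z)⟩) y D) w +
        koszul g.form (f y) u v w := by
  have h1 : covDerivAlong g.form f (fun z ↦ mfderiv J I f z (Y z)) y (X y) =
      ofCoord (f y) (coordDeriv J (fun z ↦ coordVec (f y) ⟨f z, mfderiv J I f z (Y z)⟩) y D +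
        christoffel g.form (f y) u v) := by
    have h2 : covDerivAlong g.form f (fun z ↦ mfderiv J I f z (Y z)) y (X y) =
      ofCoord (f y) (coordDeriv J (fun z ↦ coordVec (f y) ⟨f z, mfderiv J I f z (Y z)⟩) y D +
        christoffel g.form (f y) (coordVec (f y) ⟨f y, mfderiv J I f y (X y)⟩)
          (coordVec (f y) ⟨f y, mfderiv J I f y (Y y)⟩)) := by
      rw [hD]; rfl
    rw [h2, coordVec_self, coordVec_self, hu, hv]
  unfold secondFundamentalForm
  rw [h1, ← coordBilin_christoffel (g.nondegenerate (f y)), ← add_apply, ← map_add, hw]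
  exact (congrArg (fun t : E ↦ g.form (f y) t (ξ y)) (ofCoord_apply (f y) _)).trans
    (coordBilin_self g.form (f y) _ _).symm

/-- The tangent lift of $Y$ is $(dF(Y),Y)$. Pairing its derivative with $a(1,G)$ yields
$-a\,\partial_u(dF)(v)$, and the Christoffel term is $a$ times `koszul` at $(u,v,G)$. Together they
form $-a$ times the Hessian. -/
theorem secondFundamentalForm_incl [FiniteDimensional ℝ E] [I.Boundaryless]
    (g : SemiRiemannianMetric I M) (F : C^∞⟮I, M; 𝓘(ℝ, ℝ), ℝ⟯) {p : M}
    (ξ : Π y : Hypersurface F, TangentSpace (𝓘(ℝ, ℝ).prod I) (Hypersurface.incl F y))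
    (X : Π y : Hypersurface F, TangentSpace I y) {Y : Π y : Hypersurface F, TangentSpace I y}
    {U : Set (Hypersurface F)} {q : Hypersurface F} (hq : q = (Hypersurface.proj F).symm p)
    (hU : U ∈ 𝓝 q) (hY : IsSmoothAlongOn I id Y U) {G : E}
    (hG : ∀ v : E, coordBilin g.form p p G v = coordDiff I F p p v) {a : ℝ}
    (hξ : ξ q = ((a, a • G) : ℝ × E)) {u v : E} (hu : u = X q) (hv : v = Y q) :
    secondFundamentalForm (ambientMetric g).form (Hypersurface.incl F) ξ X Y q =
      -a * hessCoord g.form F p G u v := by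
  subst hq
  rw [secondFundamentalForm_eq (ambientMetric g) (Hypersurface.incl F) ξ X Y
    ((Hypersurface.proj F).symm p) (u := (coordDiff I F p p u, u)) (v := (coordDiff I F p p v, v))
    (w := (a, a • G)) (D := u) (by rw [← hu]; exact (Hypersurface.mfderiv_incl_proj_symm F p u).symm)
    (by rw [← hv]; exact (Hypersurface.mfderiv_incl_proj_symm F p v).symm) hξ.symm hu]
  have hZ : IsSmoothAlongOn I (Hypersurface.incl F)
      (fun z ↦ mfderiv I (𝓘(ℝ, ℝ).prod I) (Hypersurface.incl F) z (Y z)) U :=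
    ((Hypersurface.contMDiff_incl F).contMDiff_tangentMap (m := ∞) (by simp)).comp_contMDiffOn hY
  obtain ⟨h, hh⟩ : ∃ h : Hypersurface F → ℝ × E, h = fun z ↦
      coordVec (Hypersurface.incl F ((Hypersurface.proj F).symm p)) ⟨Hypersurface.incl F z,
        mfderiv I (𝓘(ℝ, ℝ).prod I) (Hypersurface.incl F) z (Y z)⟩ := ⟨_, rfl⟩
  have hhd : MDifferentiableAt I 𝓘(ℝ, ℝ × E) h ((Hypersurface.proj F).symm p) :=
    hh ▸ hZ.mdifferentiableAt_coordVec hU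
  rw [← hh]
  obtain ⟨c, hc⟩ : ∃ c : M → E, c = fun x ↦ coordVec (I := I) p ⟨x, Y ((Hypersurface.proj F).symm x)⟩ :=
    ⟨_, rfl⟩
  have hcd : MDifferentiableAt I 𝓘(ℝ, E) c p :=
    hc ▸ (Hypersurface.isSmoothAlongOn_comp_proj_symm F hY).mdifferentiableAt_coordVec
      ((Hypersurface.proj F).symm.continuous.continuousAt hU)
  have hcp : c p = v := by
    rw [hc, hv]
    exact coordVec_self p _
  have hFd := mdifferentiableAt_coordDiff F.contMDiff p
  set L : ℝ × E →L[ℝ] ℝ := (coordBilin (ambientMetric g).form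
    (Hypersurface.incl F ((Hypersurface.proj F).symm p))
    (Hypersurface.incl F ((Hypersurface.proj F).symm p))).flip (a, a • G) with hL
  have hLapply : ∀ z : ℝ × E, L z = -(z.1 * a) + a * coordDiff I F p p z.2 := by
    intro z
    have h1 := coordBilin_ambientForm g.form (Hypersurface.incl F ((Hypersurface.proj F).symm p))
      (Hypersurface.incl F ((Hypersurface.proj F).symm p)) (mem_chart_source H p) z (a, a • G)
    refine h1.trans ?_
    have h2 : coordBilin g.form p p z.2 (a • G) = a * coordDiff I F p p z.2 := by
      rw [map_smul, smul_eq_mul, ← hG]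
      exact congrArg (a * ·) (g.symm _ _ _)
    exact congrArg _ h2
  have h1 : L (coordDeriv I h ((Hypersurface.proj F).symm p) u) =
      coordDeriv I (fun x ↦ L (h ((Hypersurface.proj F).symm x))) p u := by
    have h2 := coordDeriv_clm_apply (mdifferentiableAt_const (c := L)) hhd u
    rw [coordDeriv_const, zero_apply, zero_apply, zero_add] at h2
    rw [← h2, Hypersurface.coordDeriv_eq_comp_proj_symm]
    exact (mdifferentiableAt_const (c := L)).clm_apply hhd
  -- The functional $L$, frozen at $p$, sends the lift to $a(dF_p-dF_x)(Y)$. Its first factor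
  -- vanishes at $p$, so the derivative of $Y$ drops out.
  have h2 : (fun x ↦ L (h ((Hypersurface.proj F).symm x))) =ᶠ[𝓝 p]
      fun x ↦ (a • (coordDiff I F p p - coordDiff I F p x)) (c x) := by
    filter_upwards [chart_source_mem_nhds H p] with x hx
    have h3 : h ((Hypersurface.proj F).symm x) = (coordDiff I F p x (c x), c x) := by
      rw [hh]
      have h4 := Hypersurface.mfderiv_incl F ((Hypersurface.proj F).symm x)
        (Y ((Hypersurface.proj F).symm x))
      have h5 := coordVec_prod (I := I) (F p, p) (F x, x) hx
        (mvfderiv I F x (Y ((Hypersurface.proj F).symm x))) (Y ((Hypersurface.proj F).symm x))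
      refine (congrArg (fun t : ℝ × E ↦ coordVec (I := 𝓘(ℝ, ℝ).prod I) (F p, p)
        ⟨(F x, x), t⟩) h4).trans (h5.trans ?_)
      rw [hc]
      exact Prod.ext (coordDiff_coordVec F hx _).symm rfl
    rw [hLapply, h3]
    simp only [smul_apply, sub_apply, smul_eq_mul]
    ring
  have h3 : MDifferentiableAt I 𝓘(ℝ, E →L[ℝ] ℝ)
      (fun x ↦ a • (coordDiff I F p p - coordDiff I F p x)) p :=
    (mdifferentiableAt_const.sub hFd).const_smul a
  have h4 : coordDeriv I (fun x ↦ a • (coordDiff I F p p - coordDiff I F p x)) p =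
      -(a • coordDeriv I (coordDiff I F p) p) := by
    ext1 w
    exact coordDeriv_smul_const_sub _ a hFd w
  have h5 : koszul (ambientMetric g).form (Hypersurface.incl F ((Hypersurface.proj F).symm p))
      (coordDiff I F p p u, u) (coordDiff I F p p v, v) (a, a • G) =
      a * koszul g.form p u v G := by
    have h6 : ∀ x y z : ℝ × E, partialBilin (ambientMetric g).form
        (Hypersurface.incl F ((Hypersurface.proj F).symm p)) x y z =
        partialBilin g.form p x.2 y.2 z.2 := partialBilin_ambientForm g.smooth (F p, p)
    unfold koszul
    rw [h6, h6, h6]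
    exact koszul_smul g.form p u v G a
  refine (congrArg₂ (· + ·) h1 h5).trans ?_
  rw [coordDeriv_congr h2]
  rw [coordDeriv_clm_apply h3 hcd, h4, hessCoord_apply, hcp]
  simp only [sub_self, smul_zero, zero_apply, neg_apply, smul_apply, smul_eq_mul]
  ring

end SecondFundamentalForm

/-! ### Indefinite orthonormal families and traces -/

section LinearAlgebra

variable {V : Type*} [AddCommGroup V] [Module ℝ V] [TopologicalSpace V]

/-- A family which is orthonormal with respect to an indefinite bilinear form. -/
structure IsPseudoOrthonormal (b : V →L[ℝ] V →L[ℝ] ℝ) {k : ℕ} (e : Fin k → V) : Prop where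
  orthogonal : ∀ j l, j ≠ l → b (e j) (e l) = 0
  unit : ∀ j, b (e j) (e j) = 1 ∨ b (e j) (e j) = -1

namespace IsPseudoOrthonormal

variable {b : V →L[ℝ] V →L[ℝ] ℝ} {k : ℕ} {e : Fin k → V}

theorem mul_self (he : IsPseudoOrthonormal b e) (j : Fin k) :
    b (e j) (e j) * b (e j) (e j) = 1 := by
  rcases he.unit j with h | h <;> rw [h] <;> norm_num

theorem apply_sum (he : IsPseudoOrthonormal b e) (c : Fin k → ℝ) (l : Fin k) :
    b (∑ j, c j • e j) (e l) = c l * b (e l) (e l) := by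
  simp only [map_sum, map_smul, sum_apply, smul_apply, smul_eq_mul]
  rw [Finset.sum_eq_single l]
  · intro j _ hj
    rw [he.orthogonal j l hj, mul_zero]
  · simp

theorem linearIndependent (he : IsPseudoOrthonormal b e) : LinearIndependent ℝ e := by
  rw [Fintype.linearIndependent_iff]
  intro c hc l
  have h := he.apply_sum c l
  rw [hc, map_zero, zero_apply] at h
  have := he.mul_self l
  rcases mul_eq_zero.1 h.symm with h | h
  · exact h
  · rw [h] at this; norm_num at this

theorem sum_smul_eq (he : IsPseudoOrthonormal b e) {v : V}
    (hv : v ∈ Submodule.span ℝ (range e)) :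
    ∑ j, (b (e j) (e j) * b v (e j)) • e j = v := by
  obtain ⟨c, rfl⟩ := (Submodule.mem_span_range_iff_exists_fun ℝ).1 hv
  refine Finset.sum_congr rfl fun j _ ↦ ?_
  rw [he.apply_sum, mul_comm, mul_assoc, he.mul_self, mul_one]

/-- The trace of a bilinear form with respect to an indefinite scalar product does not depend on the
orthonormal basis. -/
theorem sum_eq_sum (he : IsPseudoOrthonormal b e) (hb : ∀ v w, b v w = b w v) {m : ℕ}
    {f : Fin m → V} (hf : IsPseudoOrthonormal b f)
    (hef : Submodule.span ℝ (range e) = Submodule.span ℝ (range f)) (h : V →L[ℝ] V →L[ℝ] ℝ) :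
    ∑ j, b (e j) (e j) * h (e j) (e j) = ∑ i, b (f i) (f i) * h (f i) (f i) := by
  -- Expand the second slot of $h(e_j,e_j)$ along $f$ and the first slot of $h(f_i,f_i)$ along $e$.
  -- Both sums become the double sum of $\varepsilon_j\varepsilon_i\,b(e_j,f_i)\,h(e_j,f_i)$.
  have h1 : ∀ j, h (e j) (e j) = ∑ i, b (f i) (f i) * b (e j) (f i) * h (e j) (f i) := by
    intro j
    have := congrArg (h (e j)) (hf.sum_smul_eq
      (hef ▸ Submodule.subset_span (mem_range_self j) : e j ∈ Submodule.span ℝ (range f)))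
    rw [← this]
    simp [map_sum]
  have h2 : ∀ i, h (f i) (f i) = ∑ j, b (e j) (e j) * b (f i) (e j) * h (e j) (f i) := by
    intro i
    have := congrArg (fun v ↦ h v (f i)) (he.sum_smul_eq
      (hef ▸ Submodule.subset_span (mem_range_self i) : f i ∈ Submodule.span ℝ (range e)))
    rw [← this]
    simp [map_sum]
  simp_rw [h1, h2, Finset.mul_sum]
  rw [Finset.sum_comm]
  refine Finset.sum_congr rfl fun i _ ↦ Finset.sum_congr rfl fun j _ ↦ ?_
  rw [hb (f i) (e j)]
  ring

end IsPseudoOrthonormal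

/-- Diagonalise the restriction of $b$ to $D$. Nondegeneracy on $D$ excludes null vectors from an
orthogonal basis, which can then be rescaled. -/
theorem exists_isPseudoOrthonormal [FiniteDimensional ℝ V] {b : V →L[ℝ] V →L[ℝ] ℝ}
    (hb : ∀ v w, b v w = b w v) {D : Submodule ℝ V}
    (hD : ∀ v ∈ D, (∀ w ∈ D, b v w = 0) → v = 0) {k : ℕ} (hk : Module.finrank ℝ D = k) :
    ∃ e : Fin k → V, IsPseudoOrthonormal b e ∧ ∀ j, e j ∈ D := by
  subst hk
  let B : LinearMap.BilinForm ℝ D :=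
    LinearMap.mk₂ ℝ (fun v w : D ↦ b v w) (by simp) (by simp) (by simp) (by simp)
  have hB : LinearMap.IsSymm B := ⟨fun v w ↦ hb v w⟩
  obtain ⟨v, hv⟩ := LinearMap.BilinForm.exists_orthogonal_basis hB
  have hsep : B.SeparatingLeft := by
    intro x hx
    exact Subtype.ext (hD x x.2 fun w hw ↦ hx ⟨w, hw⟩)
  have hne : ∀ i, b (v i) (v i) ≠ 0 := fun i ↦
    LinearMap.IsOrthoᵢ.not_isOrtho_basis_self_of_separatingLeft hv hsep i
  refine ⟨fun j ↦ (Real.sqrt |b (v j) (v j)|)⁻¹ • (v j : V), ⟨fun j l hjl ↦ ?_, fun j ↦ ?_⟩,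
    fun j ↦ D.smul_mem _ (v j).2⟩
  · have : b (v j) (v l) = 0 := hv hjl
    simp [this]
  · have h1 : b ((Real.sqrt |b (v j) (v j)|)⁻¹ • (v j : V)) ((Real.sqrt |b (v j) (v j)|)⁻¹ • (v j : V))
        = b (v j) (v j) / |b (v j) (v j)| := by
      simp only [map_smul, smul_apply, smul_eq_mul]
      rw [← mul_assoc, ← mul_inv, Real.mul_self_sqrt (abs_nonneg _), div_eq_inv_mul]
    rw [h1]
    rcases lt_or_gt_of_ne (hne j) with h | h
    · right; rw [abs_of_neg h, div_neg, div_self h.ne]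
    · left; rw [abs_of_pos h, div_self h.ne']

end LinearAlgebra

/-! ### Smooth local orthonormal frames -/

section Frames

variable {E : Type*} [NormedAddCommGroup E] [NormedSpace ℝ E]
  {H : Type*} [TopologicalSpace H] {I : ModelWithCorners ℝ E H}
  {M : Type*} [TopologicalSpace M] [ChartedSpace H M] [IsManifold I ∞ M]

theorem IsSmoothBilin.contMDiffOn_apply {b : BilinField I M} (hb : IsSmoothBilin b)
    {X Y : Π x : M, TangentSpace I x} {U : Set M} (hX : IsSmoothAlongOn I id X U)
    (hY : IsSmoothAlongOn I id Y U) :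
    ContMDiffOn I 𝓘(ℝ, ℝ) ∞ (fun x ↦ b x (X x) (Y x)) U := by
  intro x hx
  have : ContMDiffWithinAt I (I.prod 𝓘(ℝ)) ∞
      (fun m ↦ TotalSpace.mk' ℝ (E := Bundle.Trivial M ℝ) m (b m (X m) (Y m))) U x := by
    apply ContMDiffWithinAt.clm_bundle_apply₂ (F₁ := E) (F₂ := E)
    · exact (hb x).contMDiffWithinAt
    · exact hX x hx
    · exact hY x hx
  simp only [contMDiffWithinAt_totalSpace] at this
  exact this.2

theorem IsSmoothAlongOn.contMDiffOn_mvfderiv {F : M → ℝ} (hF : ContMDiff I 𝓘(ℝ, ℝ) ∞ F)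
    {Y : Π x : M, TangentSpace I x} {U : Set M} (hY : IsSmoothAlongOn I id Y U) :
    ContMDiffOn I 𝓘(ℝ, ℝ) ∞ (fun x ↦ mvfderiv I F x (Y x)) U :=
  (contMDiff_snd_tangentBundle_modelSpace ℝ 𝓘(ℝ, ℝ)).comp_contMDiffOn
    ((hF.contMDiff_tangentMap (m := ∞) (by simp)).comp_contMDiffOn hY)

theorem IsSmoothAlongOn.sub {X Y : Π x : M, TangentSpace I x} {U : Set M}
    (hX : IsSmoothAlongOn I id X U) (hY : IsSmoothAlongOn I id Y U) :
    IsSmoothAlongOn I id (fun x ↦ X x - Y x) U :=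
  ContMDiffOn.sub_section hX hY

theorem IsSmoothAlongOn.smul {X : Π x : M, TangentSpace I x} {f : M → ℝ} {U : Set M}
    (hf : ContMDiffOn I 𝓘(ℝ, ℝ) ∞ f U) (hX : IsSmoothAlongOn I id X U) :
    IsSmoothAlongOn I id (fun x ↦ f x • X x) U :=
  ContMDiffOn.smul_section hf hX

theorem IsSmoothAlongOn.sum {ι : Type*} {s : Finset ι} {X : ι → Π x : M, TangentSpace I x}
    {U : Set M} (hX : ∀ i ∈ s, IsSmoothAlongOn I id (X i) U) :
    IsSmoothAlongOn I id (fun x ↦ ∑ i ∈ s, X i x) U :=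
  ContMDiffOn.sum_section hX

/-- Indefinite Gram–Schmidt may meet null vectors. Starting from fields already orthonormal at $x$,
each correction vanishes at $x$, so the corrected field has square $\pm1$ there and remains non-null
on a smaller neighbourhood. -/
theorem exists_orthonormal_fields {b : BilinField I M} (hb : IsSmoothBilin b)
    (hs : ∀ (x : M) (v w : TangentSpace I x), b x v w = b x w v) {x : M} {k : ℕ}
    {s : Fin k → Π y : M, TangentSpace I y} {U : Set M} (hU : IsOpen U) (hx : x ∈ U)
    (hsm : ∀ j, IsSmoothAlongOn I id (s j) U)
    (hsx : IsPseudoOrthonormal (b x) fun j ↦ s j x) :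
    ∃ W ⊆ U, IsOpen W ∧ x ∈ W ∧ ∃ e : Fin k → Π y : M, TangentSpace I y,
      (∀ j, IsSmoothAlongOn I id (e j) W) ∧ (∀ y ∈ W, IsPseudoOrthonormal (b y) fun j ↦ e j y) ∧
      (∀ j, e j x = s j x) ∧
      ∀ y ∈ W, ∀ j, e j y ∈ Submodule.span ℝ (range fun j ↦ s j y) := by
  induction k with
  | zero =>
    exact ⟨U, subset_rfl, hU, hx, s, hsm, fun y _ ↦ ⟨fun j ↦ j.elim0, fun j ↦ j.elim0⟩,
      fun _ ↦ rfl, fun y _ j ↦ j.elim0⟩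
  | succ k ih =>
    obtain ⟨W, hWU, hW, hxW, e, hes, heo, hex, hesp⟩ := ih (s := fun j ↦ s j.castSucc)
      (fun j ↦ hsm _) ⟨fun j l hjl ↦ hsx.orthogonal _ _ (by simpa using hjl), fun j ↦ hsx.unit _⟩
    let t := s (Fin.last k)
    have ht : IsSmoothAlongOn I id t W := (hsm _).mono hWU
    let w : Π y : M, TangentSpace I y := fun y ↦
      t y - ∑ i, (b y (e i y) (e i y) * b y (t y) (e i y)) • e i y
    have hw : IsSmoothAlongOn I id w W := ht.sub <| .sum fun i _ ↦ .smul
      ((hb.contMDiffOn_apply (hes i) (hes i)).mul (hb.contMDiffOn_apply ht (hes i))) (hes i)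
    have hwx : w x = t x := by
      have : ∀ i, b x (t x) (e i x) = 0 := fun i ↦ by
        rw [hex]; exact hsx.orthogonal _ _ (Fin.castSucc_lt_last i).ne'
      simp [w, this]
    have hwe : ∀ y ∈ W, ∀ i, b y (w y) (e i y) = 0 := by
      intro y hy i
      have h1 := (heo y hy).apply_sum (fun i ↦ b y (e i y) (e i y) * b y (t y) (e i y)) i
      simp only [w, map_sub, sub_apply]
      rw [h1, mul_comm, ← mul_assoc, (heo y hy).mul_self, one_mul, sub_self]
    have hwspan : ∀ y ∈ W, w y ∈ Submodule.span ℝ (range fun j ↦ s j y) := by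
      intro y hy
      refine Submodule.sub_mem _ (Submodule.subset_span ⟨_, rfl⟩)
        (Submodule.sum_mem _ fun i _ ↦ Submodule.smul_mem _ _ ?_)
      exact Submodule.span_mono (by rintro _ ⟨j, rfl⟩; exact ⟨j.castSucc, rfl⟩) (hesp y hy i)
    -- The causal sign at $x$: multiplying by it gives $\varphi(x)=1$, and the square root is taken
    -- on the open set where $\varphi>0$.
    obtain ⟨σ, hσ, hσx⟩ : ∃ σ : ℝ, (σ = 1 ∨ σ = -1) ∧ b x (w x) (w x) = σ := by
      rw [hwx]; exact ⟨_, hsx.unit _, rfl⟩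
    have hσσ : σ * σ = 1 := by rcases hσ with h | h <;> rw [h] <;> norm_num
    let φ : M → ℝ := fun y ↦ σ * b y (w y) (w y)
    have hφ : ContMDiffOn I 𝓘(ℝ, ℝ) ∞ φ W := contMDiffOn_const.mul (hb.contMDiffOn_apply hw hw)
    have hφx : φ x = 1 := by simp only [φ, hσx, hσσ]
    let W' := W ∩ φ ⁻¹' Ioi 0
    have hW' : IsOpen W' := hφ.continuousOn.isOpen_inter_preimage hW isOpen_Ioi
    have hsq : ContMDiffOn I 𝓘(ℝ, ℝ) ∞ (fun y ↦ (Real.sqrt (φ y))⁻¹) W' := by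
      intro y hy
      have hpos : 0 < φ y := hy.2
      have h1 : ContDiffAt ℝ ∞ (fun r : ℝ ↦ (Real.sqrt r)⁻¹) (φ y) :=
        (contDiffAt_id.sqrt hpos.ne').inv (Real.sqrt_pos.2 hpos).ne'
      exact h1.contMDiffAt.comp_contMDiffWithinAt y ((hφ y hy.1).mono inter_subset_left)
    refine ⟨W', inter_subset_left.trans hWU, hW', ⟨hxW, by simp [hφx]⟩,
      fun j ↦ Fin.lastCases (fun y ↦ (Real.sqrt (φ y))⁻¹ • w y) e j, ?_, ?_, ?_, ?_⟩
    · intro j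
      refine Fin.lastCases ?_ (fun i ↦ ?_) j
      · simp only [Fin.lastCases_last]
        exact .smul hsq (hw.mono inter_subset_left)
      · simp only [Fin.lastCases_castSucc]
        exact (hes i).mono inter_subset_left
    · intro y hy
      have hpos : 0 < φ y := hy.2
      constructor
      · intro j l
        refine Fin.lastCases ?_ (fun i ↦ ?_) j <;> refine Fin.lastCases ?_ (fun i' ↦ ?_) l
        · simp
        · intro _
          simp [hwe y hy.1]
        · intro _
          rw [hs]
          simp [hwe y hy.1]
        · intro h
          simp only [Fin.lastCases_castSucc]
          exact (heo y hy.1).orthogonal _ _ fun h' ↦ h (by rw [h'])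
      · intro j
        refine Fin.lastCases ?_ (fun i ↦ ?_) j
        · simp only [Fin.lastCases_last, map_smul, smul_apply, smul_eq_mul]
          have h1 : b y (w y) (w y) = σ * φ y := by
            simp only [φ]; rw [← mul_assoc, hσσ, one_mul]
          have h2 : (Real.sqrt (φ y))⁻¹ * ((Real.sqrt (φ y))⁻¹ * b y (w y) (w y)) = σ := by
            rw [h1, ← mul_assoc, ← mul_inv, Real.mul_self_sqrt hpos.le]
            field_simp
          rw [h2]; exact hσ
        · simp only [Fin.lastCases_castSucc]
          exact (heo y hy.1).unit i
    · intro j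
      refine Fin.lastCases ?_ (fun i ↦ ?_) j
      · simp [hφx, hwx, t]
      · simp [hex]
    · intro y hy j
      refine Fin.lastCases ?_ (fun i ↦ ?_) j
      · simp only [Fin.lastCases_last]
        exact Submodule.smul_mem _ _ (hwspan y hy.1)
      · simp only [Fin.lastCases_castSucc]
        exact Submodule.span_mono (by rintro _ ⟨j, rfl⟩; exact ⟨j.castSucc, rfl⟩) (hesp y hy.1 i)

theorem IsPseudoOrthonormal.span_eq {V : Type*} [AddCommGroup V] [Module ℝ V] [TopologicalSpace V]
    [FiniteDimensional ℝ V]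
    {b : V →L[ℝ] V →L[ℝ] ℝ} {k : ℕ} {e : Fin k → V} (he : IsPseudoOrthonormal b e)
    {D : Submodule ℝ V} (heD : ∀ j, e j ∈ D) (hD : Module.finrank ℝ D = k) :
    Submodule.span ℝ (range e) = D := by
  refine Submodule.eq_of_le_of_finrank_eq (Submodule.span_le.2 (range_subset_iff.2 heD)) ?_
  rw [finrank_span_eq_card he.linearIndependent, Fintype.card_fin, hD]

/-- An orthonormal basis of the fibre at $x$ is extended by combinations of a local frame with
constant coefficients, then orthonormalised. Nondegeneracy is needed at $x$ only. -/
theorem exists_isOrthonormalFrameOn [FiniteDimensional ℝ E] {b : BilinField I M}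
    (hb : IsSmoothBilin b) (hs : ∀ (x : M) (v w : TangentSpace I x), b x v w = b x w v)
    {D : Π y : M, Submodule ℝ (TangentSpace I y)} (hD : IsSmoothDistribution D) (x : M)
    (hDx : ∀ v ∈ D x, (∀ w ∈ D x, b x v w = 0) → v = 0) :
    ∃ U : Set M, IsOpen U ∧ x ∈ U ∧ ∃ e : Fin (Module.finrank ℝ (D x)) → Π y : M, TangentSpace I y,
      IsOrthonormalFrameOn b D U e := by
  have hfd : ∀ y : M, FiniteDimensional ℝ (TangentSpace I y) := fun y ↦
    inferInstanceAs (FiniteDimensional ℝ E)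
  obtain ⟨U, hU, hxU, k, s, hss, hsD⟩ := hD x
  have hrank : ∀ y ∈ U, Module.finrank ℝ (D y) = k := fun y hy ↦ by
    rw [← (hsD y hy).2, finrank_span_eq_card (hsD y hy).1, Fintype.card_fin]
  obtain ⟨e₀, he₀, he₀D⟩ := exists_isPseudoOrthonormal (hs x) hDx (hrank x hxU)
  have hP : ∀ i, ∃ c : Fin k → ℝ, ∑ j, c j • s j x = e₀ i := fun i ↦
    (Submodule.mem_span_range_iff_exists_fun ℝ).1 ((hsD x hxU).2 ▸ he₀D i)
  choose P hP using hP
  obtain ⟨W, hWU, hW, hxW, e, hes, heo, -, hesp⟩ := exists_orthonormal_fields hb hs hU hxU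
    (s := fun i y ↦ ∑ j, P i j • s j y)
    (fun i ↦ .sum fun j _ ↦ .smul contMDiffOn_const (hss j)) (by simpa only [hP] using he₀)
  rw [hrank x hxU]
  refine ⟨W, hW, hxW, e, hes, fun y hy ↦ (heo y hy).span_eq (fun j ↦ ?_) (hrank y (hWU hy)),
    fun y hy ↦ (heo y hy).orthogonal, fun y hy ↦ (heo y hy).unit⟩
  refine Submodule.span_le.2 (range_subset_iff.2 fun i ↦ ?_) (hesp y hy j)
  exact Submodule.sum_mem _ fun l _ ↦ Submodule.smul_mem _ _
    ((hsD y (hWU hy)).2 ▸ Submodule.subset_span (mem_range_self l))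

end Frames

/-! ### The unit gradient and the canonical screen -/

section Lightlike

variable {E : Type*} [NormedAddCommGroup E] [NormedSpace ℝ E]
  {H : Type*} [TopologicalSpace H] {I : ModelWithCorners ℝ E H}
  {M : Type*} [TopologicalSpace M] [ChartedSpace H M]

theorem mem_radical {b : BilinField I M} {y : M} {u : TangentSpace I y} :
    u ∈ radical b y ↔ ∀ v, b y u v = 0 :=
  LinearMap.mem_ker.trans ⟨fun h v ↦ congrArg (fun L : E →L[ℝ] ℝ ↦ L v) h,
    fun h ↦ ContinuousLinearMap.ext h⟩

/-- A vector orthogonal to $S$ is also orthogonal to the radical, hence to everything. It lies in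
$S\cap\mathrm{Rad}=0$. -/
theorem eq_zero_of_isCompl_radical {b : BilinField I M} {y : M}
    {S : Submodule ℝ (TangentSpace I y)} (hs : ∀ v w : TangentSpace I y, b y v w = b y w v)
    (hS : IsCompl S (radical b y)) {v : TangentSpace I y} (hv : v ∈ S)
    (h : ∀ w ∈ S, b y v w = 0) : v = 0 := by
  refine Submodule.disjoint_def.1 hS.disjoint v hv (mem_radical.2 fun w ↦ ?_)
  obtain ⟨a, ha, c, hc, rfl⟩ := Submodule.mem_sup.1
    (hS.sup_eq_top ▸ Submodule.mem_top : w ∈ S ⊔ radical b y)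
  rw [map_add, h a ha, hs v c, mem_radical.1 hc, add_zero]

variable [IsManifold I ∞ M]

theorem contMDiffOn_symmL (p : M) (v : E) :
    IsSmoothAlongOn I id
      (fun y ↦ (trivializationAt E (TangentSpace I : M → Type _) p).symmL ℝ y v)
      (trivializationAt E (TangentSpace I : M → Type _) p).baseSet := by
  refine (Trivialization.contMDiffOn_section_baseSet_iff (n := ∞) (IB := I)
    (trivializationAt E (TangentSpace I : M → Type _) p)).2 ?_
  refine contMDiffOn_const (c := v) |>.congr fun y hy ↦ ?_
  rw [Trivialization.symmL_apply _ hy]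
  exact congrArg Prod.snd (Trivialization.apply_mk_symm _ hy v)

theorem coordVec_linearIndependent {k : ℕ} {p y : M}
    (hy : y ∈ (trivializationAt E (TangentSpace I : M → Type _) p).baseSet)
    {s : Fin k → TangentSpace I y}
    (h : LinearIndependent ℝ (fun j ↦ coordVec p (⟨y, s j⟩ : TangentBundle I M))) :
    LinearIndependent ℝ s := by
  refine LinearIndependent.of_comp ((trivializationAt E (TangentSpace I : M → Type _)
    p).continuousLinearMapAt ℝ y : TangentSpace I y →ₗ[ℝ] E) ?_
  have key : ∀ v, (trivializationAt E (TangentSpace I : M → Type _) p).continuousLinearMapAt ℝ y v =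
      coordVec p (⟨y, v⟩ : TangentBundle I M) := fun v ↦ by
    rw [Trivialization.continuousLinearMapAt_apply, Trivialization.coe_linearMapAt_of_mem _ hy]
    rfl
  have : (fun j ↦ coordVec p (⟨y, s j⟩ : TangentBundle I M)) = _ := funext fun j ↦ (key (s j)).symm
  rw [this] at h
  exact h

/-- `G` is a smooth gradient of `F`, of unit length. -/
structure IsUnitGradient (g : SemiRiemannianMetric I M) (F : M → ℝ)
    (G : Π p : M, TangentSpace I p) : Prop where
  smooth : IsSmoothAlongOn I id G univ
  form_apply : ∀ p v, g.form p (G p) v = mvfderiv I F p v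
  mvfderiv_apply : ∀ p, mvfderiv I F p (G p) = 1

variable {g : SemiRiemannianMetric I M} {F : C^∞⟮I, M; 𝓘(ℝ, ℝ), ℝ⟯}

theorem inducedForm_apply (p : M) (u v : TangentSpace I p) :
    inducedForm g F ((Hypersurface.proj F).symm p) u v =
      -(mvfderiv I F p u * mvfderiv I F p v) + g.form p u v := by
  have h1 := Hypersurface.mfderiv_incl F ((Hypersurface.proj F).symm p) u
  have h2 := Hypersurface.mfderiv_incl F ((Hypersurface.proj F).symm p) v
  have h3 : inducedForm g F ((Hypersurface.proj F).symm p) u v = ambientForm g.form (F p, p)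
      ((mvfderiv I F p u, u) : ℝ × E) ((mvfderiv I F p v, v) : ℝ × E) :=
    congrArg₂ (fun a c : ℝ × E ↦ ambientForm g.form (F p, p) a c) h1 h2
  exact h3.trans (ambientForm_apply g.form (F p, p) _ _)

theorem inducedForm_symm (q : Hypersurface F) (u v : TangentSpace I q) :
    inducedForm g F q u v = inducedForm g F q v u :=
  (ambientMetric g).symm _ _ _

theorem mem_canonicalScreen (p : M) (v : TangentSpace I p) :
    v ∈ canonicalScreen g F ((Hypersurface.proj F).symm p) ↔ mvfderiv I F p v = 0 := by
  have h1 := Hypersurface.mfderiv_incl F ((Hypersurface.proj F).symm p) v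
  have h2 : (ambientMetric g).form (F p, p) (timeField (F p, p))
      (mfderiv I (𝓘(ℝ, ℝ).prod I) (Hypersurface.incl F) ((Hypersurface.proj F).symm p) v) =
      -(mvfderiv I F p v) := by
    refine (congrArg (fun a : ℝ × E ↦ ambientForm g.form (F p, p) (timeField (F p, p)) a)
      h1).trans ((ambientForm_apply g.form (F p, p) _ _).trans ?_)
    have h3 : ∀ w : TangentSpace I p, g.form p 0 w = 0 := fun w ↦ by
      rw [(g.form p).map_zero]; rfl
    refine (congrArg (-((1 : ℝ) * mvfderiv I F p v) + ·) (h3 v)).trans ?_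
    ring
  refine Iff.trans (b := -(mvfderiv I F p v) = 0) ?_ neg_eq_zero
  rw [← h2]
  exact Iff.rfl

/-- $G$ is a nonzero radical vector $u$ divided by $dF(u)$. Nondegeneracy makes the gradient unique,
so it agrees locally with a normalised smooth section of the radical, and the pointwise choice is
smooth. -/
theorem exists_isUnitGradient [FiniteDimensional ℝ E] (hdeg : IsLightlike (inducedForm g F)) :
    ∃ G, IsUnitGradient g F G := by
  obtain ⟨⟨r, hr, hrank⟩, hD⟩ := hdeg
  have hrad : ∀ (p : M) (u : TangentSpace I p),
      u ∈ radical (inducedForm g F) ((Hypersurface.proj F).symm p) →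
      ∀ v, g.form p u v = mvfderiv I F p u * mvfderiv I F p v := by
    intro p u hu v
    have := (inducedForm_apply p u v).symm.trans (mem_radical.1 hu v)
    linarith
  have hne : ∀ (p : M) (u : TangentSpace I p),
      u ∈ radical (inducedForm g F) ((Hypersurface.proj F).symm p) → u ≠ 0 →
      mvfderiv I F p u ≠ 0 := by
    intro p u hu hu0 h
    refine hu0 (g.nondegenerate p u fun w ↦ ?_)
    rw [hrad p u hu, h, zero_mul]
  have hex : ∀ p : M, ∃ G : TangentSpace I p, (∀ v, g.form p G v = mvfderiv I F p v) ∧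
      mvfderiv I F p G = 1 := by
    intro p
    have : FiniteDimensional ℝ (TangentSpace I ((Hypersurface.proj F).symm p)) :=
      inferInstanceAs (FiniteDimensional ℝ E)
    have hpos : 0 < Module.finrank ℝ
        (radical (inducedForm g F) ((Hypersurface.proj F).symm p)) := by rw [hrank]; exact hr
    obtain ⟨⟨u, hu⟩, hu0⟩ := (Module.finrank_pos_iff_exists_ne_zero (R := ℝ)).1 hpos
    have h0 : u ≠ 0 := fun h ↦ hu0 (Subtype.ext h)
    obtain ⟨w, hw⟩ : ∃ w : TangentSpace I p, w = u := ⟨u, rfl⟩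
    have hw0 : w ≠ 0 := fun h ↦ h0 (hw.symm.trans h)
    have hwr : w ∈ radical (inducedForm g F) ((Hypersurface.proj F).symm p) := by
      rw [hw]; exact hu
    have h1 := hne p w hwr hw0
    refine ⟨(mvfderiv I F p w)⁻¹ • w, fun v ↦ ?_, ?_⟩
    · rw [map_smul, smul_apply, hrad p w hwr, smul_eq_mul, ← mul_assoc, inv_mul_cancel₀ h1, one_mul]
    · rw [map_smul, smul_eq_mul, inv_mul_cancel₀ h1]
  choose G hG hG1 using hex
  refine ⟨G, ?_, hG, hG1⟩
  intro p _
  obtain ⟨U, hU, hpU, k, s, hs, hsp⟩ := hD ((Hypersurface.proj F).symm p)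
  -- Positive rank makes the index $0$ available in the local frame of the radical.
  have hk : 0 < k := by
    have h1 := finrank_span_eq_card (hsp _ hpU).1
    rw [(hsp _ hpU).2, hrank, Fintype.card_fin] at h1
    rwa [← h1]
  obtain ⟨t, ht⟩ : ∃ t : Π p : M, TangentSpace I p,
      t = fun p ↦ s ⟨0, hk⟩ ((Hypersurface.proj F).symm p) := ⟨_, rfl⟩
  have htr : ∀ x ∈ (Hypersurface.proj F).symm ⁻¹' U,
      t x ∈ radical (inducedForm g F) ((Hypersurface.proj F).symm x) ∧ t x ≠ 0 := by
    intro x hx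
    rw [ht]
    exact ⟨(hsp _ hx).2 ▸ Submodule.subset_span (mem_range_self _), (hsp _ hx).1.ne_zero _⟩
  have hts : IsSmoothAlongOn I id t ((Hypersurface.proj F).symm ⁻¹' U) :=
    ht ▸ Hypersurface.isSmoothAlongOn_comp_proj_symm F (hs _)
  have hV : IsOpen ((Hypersurface.proj F).symm ⁻¹' U) :=
    hU.preimage (Hypersurface.proj F).symm.continuous
  have hsm : IsSmoothAlongOn I id (fun x ↦ (mvfderiv I F x (t x))⁻¹ • t x)
      ((Hypersurface.proj F).symm ⁻¹' U) := by
    refine .smul (fun x hx ↦ ?_) hts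
    exact (hts.contMDiffOn_mvfderiv F.contMDiff x hx).inv₀ (hne x _ (htr x hx).1 (htr x hx).2)
  have hGt : ∀ x ∈ (Hypersurface.proj F).symm ⁻¹' U, G x = (mvfderiv I F x (t x))⁻¹ • t x := by
    intro x hx
    have h1 := hne x _ (htr x hx).1 (htr x hx).2
    refine sub_eq_zero.1 (g.nondegenerate x _ fun v ↦ ?_)
    rw [map_sub, map_smul, sub_apply, smul_apply, hG, hrad x _ (htr x hx).1, smul_eq_mul,
      ← mul_assoc, inv_mul_cancel₀ h1, one_mul, sub_self]
  have h2 : IsSmoothAlongOn I id G ((Hypersurface.proj F).symm ⁻¹' U) :=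
    hsm.congr fun x hx ↦ by rw [hGt x hx]
  exact (h2.contMDiffAt (hV.mem_nhds hpU)).contMDiffWithinAt

namespace IsUnitGradient

variable {G : Π p : M, TangentSpace I p}

/-- Since $\widehat g(G,\cdot)=dF$, the condition $\widehat g(u,\cdot)=dF(u)\,dF$ reads $u=dF(u)G$.
The radical is thus the line through $G$. -/
theorem mem_radical_iff (hG : IsUnitGradient g F G) (p : M) (u : TangentSpace I p) :
    u ∈ radical (inducedForm g F) ((Hypersurface.proj F).symm p) ↔ u = mvfderiv I F p u • G p := by
  refine Iff.trans mem_radical ?_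
  constructor
  · intro h
    refine sub_eq_zero.1 (g.nondegenerate p _ fun v ↦ ?_)
    have h1 := (inducedForm_apply p u v).symm.trans (h v)
    rw [map_sub, map_smul, sub_apply, smul_apply, hG.form_apply, smul_eq_mul]
    linarith
  · intro h v
    refine (inducedForm_apply p u v).trans ?_
    have h1 : ∀ w : TangentSpace I p, g.form p u w = mvfderiv I F p u * mvfderiv I F p w := by
      intro w
      conv_lhs => rw [h]
      rw [map_smul, smul_apply, hG.form_apply, smul_eq_mul]
    exact neg_add_eq_zero.2 (h1 v).symm

theorem finrank_kerDiff [FiniteDimensional ℝ E] (hG : IsUnitGradient g F G) {n : ℕ}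
    (hn : Module.finrank ℝ E = n + 1) (p : M) :
    Module.finrank ℝ (kerDiff (I := I) (F : M → ℝ) p) = n := by
  have : FiniteDimensional ℝ (TangentSpace I p) := inferInstanceAs (FiniteDimensional ℝ E)
  have h1 : (mvfderiv I F p : TangentSpace I p →ₗ[ℝ] ℝ) ≠ 0 := by
    intro h
    have h2 : mvfderiv I F p (G p) = 0 := congrArg (fun L : TangentSpace I p →ₗ[ℝ] ℝ ↦ L (G p)) h
    rw [hG.mvfderiv_apply] at h2
    exact one_ne_zero h2
  have h2 := Module.Dual.finrank_ker_add_one_of_ne_zero h1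
  have h3 : Module.finrank ℝ (TangentSpace I p) = n + 1 := hn
  rw [h3] at h2
  exact Nat.succ_injective h2

/-- Extend a basis of the kernel at $p$ with constant components and project along $G$ into $\ker
dF$. Nothing changes at $p$, independence is an open condition, and the dimension is $n$. -/
theorem exists_frame_kerDiff [FiniteDimensional ℝ E] (hG : IsUnitGradient g F G) {n : ℕ}
    (hn : Module.finrank ℝ E = n + 1) (p : M) : ∃ U : Set M, IsOpen U ∧ p ∈ U ∧
      ∃ s : Fin n → Π y : M, TangentSpace I y, (∀ j, IsSmoothAlongOn I id (s j) U) ∧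
        ∀ y ∈ U, LinearIndependent ℝ (fun j ↦ s j y) ∧
          Submodule.span ℝ (range fun j ↦ s j y) = kerDiff F y := by
  have hfd : ∀ y : M, FiniteDimensional ℝ (TangentSpace I y) := fun y ↦
    inferInstanceAs (FiniteDimensional ℝ E)
  obtain ⟨v, hvli, hvK⟩ : ∃ v : Fin n → TangentSpace I p, LinearIndependent ℝ v ∧
      ∀ j, mvfderiv I F p (v j) = 0 := by
    let v := Module.finBasisOfFinrankEq ℝ (kerDiff (I := I) (F : M → ℝ) p)
      (hG.finrank_kerDiff hn p)
    exact ⟨fun j ↦ v j, v.linearIndependent.map' (kerDiff (I := I) (F : M → ℝ) p).subtype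
      (Submodule.ker_subtype _),
      fun j ↦ LinearMap.mem_ker.1 (v j).2⟩
  obtain ⟨B, hBo, hpB, s₀, hs₀, hs₀p, hB⟩ : ∃ B : Set M, IsOpen B ∧ p ∈ B ∧
      ∃ s₀ : Fin n → Π y : M, TangentSpace I y, (∀ j, IsSmoothAlongOn I id (s₀ j) B) ∧
        (∀ j, s₀ j p = v j) ∧
        B = (trivializationAt E (TangentSpace I : M → Type _) p).baseSet :=
    ⟨_, (trivializationAt E (TangentSpace I : M → Type _) p).open_baseSet,
      mem_baseSet_trivializationAt E (TangentSpace I) p,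
      fun j y ↦ (trivializationAt E (TangentSpace I : M → Type _) p).symmL ℝ y (v j),
      fun j ↦ contMDiffOn_symmL p _, fun j ↦
        congrArg (fun L : E →L[ℝ] E ↦ L (v j)) (symmL_trivializationAt_self p), rfl⟩
  obtain ⟨s, hsdef⟩ : ∃ s : Fin n → Π y : M, TangentSpace I y,
      s = fun j y ↦ s₀ j y - mvfderiv I F y (s₀ j y) • G y := ⟨_, rfl⟩
  have hs : ∀ j, IsSmoothAlongOn I id (s j) B := fun j ↦ by
    rw [hsdef]
    exact (hs₀ j).sub (.smul ((hs₀ j).contMDiffOn_mvfderiv F.contMDiff)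
      (hG.smooth.mono (subset_univ _)))
  have hsp : ∀ j, s j p = v j := fun j ↦ by
    simp only [hsdef]
    rw [hs₀p, hvK, zero_smul, sub_zero]
  have hsK : ∀ y j, s j y ∈ kerDiff (I := I) (F : M → ℝ) y := fun y j ↦ by
    have : mvfderiv I F y (s j y) = 0 := by
      simp only [hsdef]
      rw [map_sub, map_smul, hG.mvfderiv_apply, smul_eq_mul, mul_one, sub_self]
    exact LinearMap.mem_ker.2 this
  have hc : ContinuousAt (fun y j ↦ coordVec p (⟨y, s j y⟩ : TangentBundle I M)) p :=
    continuousAt_pi.2 fun j ↦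
      ((hs j).mdifferentiableAt_coordVec (hBo.mem_nhds hpB)).continuousAt
  have hli : LinearIndependent ℝ fun j ↦ coordVec p (⟨p, s j p⟩ : TangentBundle I M) := by
    simp only [coordVec_self, hsp]
    exact hvli
  have hev := hc.eventually hli.eventually
  obtain ⟨W, hW, hWo, hpW⟩ := mem_nhds_iff.1 (hev.and (hBo.mem_nhds hpB))
  refine ⟨W, hWo, hpW, s, fun j ↦ (hs j).mono fun y hy ↦ (hW hy).2, fun y hy ↦ ?_⟩
  have hly : LinearIndependent ℝ fun j ↦ s j y := 
    coordVec_linearIndependent (hB ▸ (hW hy).2) (hW hy).1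
  refine ⟨hly, Submodule.eq_of_le_of_finrank_eq
    (Submodule.span_le.2 (range_subset_iff.2 (hsK y))) ?_⟩
  rw [finrank_span_eq_card hly, Fintype.card_fin, hG.finrank_kerDiff hn]

/-- The splitting is $v=(v-dF(v)G)+dF(v)G$. -/
theorem isScreenDistribution_canonicalScreen [FiniteDimensional ℝ E] (hG : IsUnitGradient g F G)
    {n : ℕ} (hn : Module.finrank ℝ E = n + 1) :
    IsScreenDistribution (inducedForm g F) (canonicalScreen g F) := by
  refine ⟨fun q ↦ ?_, fun q ↦ ?_⟩
  · obtain ⟨p, rfl⟩ := (Hypersurface.proj F).symm.surjective q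
    obtain ⟨U, hU, hpU, s, hs, hsU⟩ := hG.exists_frame_kerDiff hn p
    refine ⟨Hypersurface.proj F ⁻¹' U, hU.preimage (Hypersurface.proj F).continuous, hpU, n,
      fun j q ↦ s j (Hypersurface.proj F q),
      fun j ↦ Hypersurface.isSmoothAlongOn_comp_proj F (hs j), fun z hz ↦ ?_⟩
    obtain ⟨x, rfl⟩ := (Hypersurface.proj F).symm.surjective z
    refine ⟨(hsU x hz).1, (hsU x hz).2.trans ?_⟩
    ext v
    exact (mem_canonicalScreen x v).symm
  · obtain ⟨p, rfl⟩ := (Hypersurface.proj F).symm.surjective q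
    constructor
    · refine Submodule.disjoint_def.2 fun u hu hu' ↦ ?_
      have h1 := (mem_canonicalScreen p u).1 hu
      have h2 := (hG.mem_radical_iff p u).1 hu'
      rw [h1, zero_smul] at h2
      exact h2
    · refine codisjoint_iff_le_sup.2 fun v _ ↦ ?_
      obtain ⟨w, hw⟩ : ∃ w : TangentSpace I p, w = v := ⟨v, rfl⟩
      have h1 : w - mvfderiv I F p w • G p ∈
          canonicalScreen g F ((Hypersurface.proj F).symm p) := by
        refine (mem_canonicalScreen p _).2 ?_
        rw [map_sub, map_smul, hG.mvfderiv_apply, smul_eq_mul, mul_one, sub_self]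
      have h2 : mvfderiv I F p w • G p ∈
          radical (inducedForm g F) ((Hypersurface.proj F).symm p) := by
        refine (hG.mem_radical_iff p _).2 ?_
        rw [map_smul, hG.mvfderiv_apply, smul_eq_mul, mul_one]
      refine Submodule.mem_sup.2 ⟨_, h1, _, h2, ?_⟩
      rw [← hw]
      exact sub_add_cancel w _

end IsUnitGradient

end Lightlike

/-! ### Minimality as vanishing of the trace of the Hessian on $\ker dF$ -/

section Minimal

variable {E : Type*} [NormedAddCommGroup E] [NormedSpace ℝ E]
  {H : Type*} [TopologicalSpace H] {I : ModelWithCorners ℝ E H}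
  {M : Type*} [TopologicalSpace M] [ChartedSpace H M] [IsManifold I ∞ M]
  {g : SemiRiemannianMetric I M} {F : C^∞⟮I, M; 𝓘(ℝ, ℝ), ℝ⟯} {G : Π p : M, TangentSpace I p}

namespace IsUnitGradient

/-- All complements of the radical have the same dimension, and the canonical one is $\ker dF$. -/
theorem finrank_screen [FiniteDimensional ℝ E] (hG : IsUnitGradient g F G) {n : ℕ}
    (hn : Module.finrank ℝ E = n + 1) {S : Π q : Hypersurface F, Submodule ℝ (TangentSpace I q)}
    (hS : IsScreenDistribution (inducedForm g F) S) (p : M) :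
    Module.finrank ℝ (S ((Hypersurface.proj F).symm p)) = n := by
  have : FiniteDimensional ℝ (TangentSpace I ((Hypersurface.proj F).symm p)) :=
    inferInstanceAs (FiniteDimensional ℝ E)
  have h1 := Submodule.finrank_add_eq_of_isCompl (hS.2 ((Hypersurface.proj F).symm p))
  have h2 := Submodule.finrank_add_eq_of_isCompl
    ((hG.isScreenDistribution_canonicalScreen hn).2 ((Hypersurface.proj F).symm p))
  have h3 : Module.finrank ℝ (canonicalScreen g F ((Hypersurface.proj F).symm p)) = n := by
    rw [← hG.finrank_kerDiff hn p]
    have : canonicalScreen g F ((Hypersurface.proj F).symm p) =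
        (kerDiff (I := I) (F : M → ℝ) p : Submodule ℝ (TangentSpace I p)) :=
      Submodule.ext fun v ↦ mem_canonicalScreen p v
    exact congrArg (fun D : Submodule ℝ E ↦ Module.finrank ℝ D) this
  omega

/-- Subtracting $dF(u)G$ removes a radical component, and on $\ker dF$ the induced form is $\widehat
g$. So the projection carries orthonormal frames of any screen to orthonormal frames of $\ker dF$.
-/
theorem form_sub_smul (hG : IsUnitGradient g F G) (p : M) (u v : TangentSpace I p) :
    g.form p (u - mvfderiv I F p u • G p) (v - mvfderiv I F p v • G p) =
      inducedForm g F ((Hypersurface.proj F).symm p) u v := by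
  refine Eq.trans ?_ (inducedForm_apply p u v).symm
  have h1 : g.form p u (G p) = mvfderiv I F p u := (g.symm _ _ _).trans (hG.form_apply p u)
  simp only [map_sub, map_smul, sub_apply, smul_apply, smul_eq_mul, h1, hG.form_apply,
    hG.mvfderiv_apply]
  ring

theorem sub_smul_mem_kerDiff (hG : IsUnitGradient g F G) (p : M) (u : TangentSpace I p) :
    u - mvfderiv I F p u • G p ∈ kerDiff (I := I) (F : M → ℝ) p := by
  have : mvfderiv I F p (u - mvfderiv I F p u • G p) = 0 := by
    rw [map_sub, map_smul, hG.mvfderiv_apply, smul_eq_mul, mul_one, sub_self]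
  exact LinearMap.mem_ker.2 this

theorem isPseudoOrthonormal_sub_smul (hG : IsUnitGradient g F G) (p : M) {k : ℕ}
    {e : Fin k → TangentSpace I p}
    (horth : ∀ j l, j ≠ l → inducedForm g F ((Hypersurface.proj F).symm p) (e j) (e l) = 0)
    (hunit : ∀ j, inducedForm g F ((Hypersurface.proj F).symm p) (e j) (e j) = 1 ∨
      inducedForm g F ((Hypersurface.proj F).symm p) (e j) (e j) = -1) :
    IsPseudoOrthonormal (g.form p) fun j ↦ e j - mvfderiv I F p (e j) • G p :=
  ⟨fun j l hjl ↦ (hG.form_sub_smul p _ _).trans (horth j l hjl), fun j ↦ by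
    rw [hG.form_sub_smul]; exact hunit j⟩

theorem hessCoord_sub_smul [I.Boundaryless] (hG : IsUnitGradient g F G) (p : M)
    (u : TangentSpace I p) (c : ℝ) :
    hessCoord g.form F p (G p) (u - c • G p : TangentSpace I p) (u - c • G p : TangentSpace I p) =
      hessCoord g.form F p (G p) u u := by
  have h1 : ∀ w : E, hessCoord g.form F p (G p) w (G p) = 0 :=
    hessCoord_gradient g F.contMDiff univ_mem hG.smooth (fun y _ ↦ hG.form_apply y)
      fun y _ ↦ hG.mvfderiv_apply y
  have h2 := hessCoord_add_smul g.form F p (G p) u u (-c) (-c) h1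
    fun w ↦ (hessCoord_symm g F.contMDiff p _ _ _).trans (h1 w)
  have h3 : u - c • G p = u + (-c) • G p := by rw [neg_smul, sub_eq_add_neg]
  rw [h3]
  exact h2

theorem secondFundamentalForm_incl [FiniteDimensional ℝ E] [I.Boundaryless]
    (hG : IsUnitGradient g F G) (p : M)
    (ξ : Π y : Hypersurface F, TangentSpace (𝓘(ℝ, ℝ).prod I) (Hypersurface.incl F y))
    {Y : Π y : Hypersurface F, TangentSpace I y} {U : Set (Hypersurface F)}
    (hU : U ∈ 𝓝 ((Hypersurface.proj F).symm p)) (hY : IsSmoothAlongOn I id Y U)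
    {a : ℝ} (hξ : ξ ((Hypersurface.proj F).symm p) = ((a, (a • G p : TangentSpace I p)) : ℝ × E)) :
    secondFundamentalForm (ambientMetric g).form (Hypersurface.incl F) ξ Y Y
      ((Hypersurface.proj F).symm p) =
      -a * hessCoord g.form F p (G p) (Y ((Hypersurface.proj F).symm p))
        (Y ((Hypersurface.proj F).symm p)) := by
  refine MongeType.secondFundamentalForm_incl g F ξ Y rfl hU hY (G := G p) (fun v ↦ ?_) hξ rfl rfl
  exact (coordBilin_self g.form p _ _).trans
    ((hG.form_apply p v).trans (coordDiff_self F p v).symm)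

/-- Orthogonality of $(a,w)$ to all $(dF(v),v)$ says $\widehat g(w,v)=a\,dF(v)=\widehat g(aG,v)$,
whence $w=aG$. -/
theorem eq_of_mem_normalSpace (hG : IsUnitGradient g F G) (p : M)
    {ξ : ℝ × E} (hξ : ∀ v : TangentSpace I p, ambientForm g.form (F p, p) ξ
      (mfderiv I (𝓘(ℝ, ℝ).prod I) (Hypersurface.incl F) ((Hypersurface.proj F).symm p) v) = 0) :
    ξ = (ξ.1, (ξ.1 • G p : TangentSpace I p)) := by
  obtain ⟨w, hw⟩ : ∃ w : TangentSpace I p, w = ξ.2 := ⟨ξ.2, rfl⟩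
  have h1 : w = ξ.1 • G p := by
    refine sub_eq_zero.1 (g.nondegenerate p _ fun v ↦ ?_)
    have h2 := (congrArg (fun a : ℝ × E ↦ ambientForm g.form (F p, p) ξ a)
      (Hypersurface.mfderiv_incl F ((Hypersurface.proj F).symm p) v)).symm.trans (hξ v)
    have h3 : -(ξ.1 * mvfderiv I F p v) + g.form p w v = 0 := by
      rw [hw]
      exact (ambientForm_apply g.form (F p, p) _ _).symm.trans h2
    rw [map_sub, map_smul, sub_apply, smul_apply, hG.form_apply, smul_eq_mul]
    linarith
  exact Prod.ext rfl (hw.symm.trans h1)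

/-- The required frame is the projection to $\ker dF$ of an orthonormal frame of the screen.
Projection preserves both the signs and the Hessian values, so minimality transfers term by term. -/
theorem exists_frame_of_isMinimal [FiniteDimensional ℝ E] [I.Boundaryless]
    (hG : IsUnitGradient g F G) {n : ℕ} (hn : Module.finrank ℝ E = n + 1)
    {S : Π q : Hypersurface F, Submodule ℝ (TangentSpace I q)}
    (hS : IsScreenDistribution (inducedForm g F) S)
    (hmin : IsMinimal (ambientMetric g).form (Hypersurface.incl F) S) (p : M) :
    ∃ U : Set M, IsOpen U ∧ p ∈ U ∧ ∃ e : Fin n → Π x : M, TangentSpace I x,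
      IsOrthonormalFrameOn g.form (kerDiff F) U e ∧
      ∀ x ∈ U, ∑ j, g.form x (e j x) (e j x) * hess g.form F (e j) (e j) x = 0 := by
  have hfd : ∀ y : M, FiniteDimensional ℝ (TangentSpace I y) := fun y ↦
    inferInstanceAs (FiniteDimensional ℝ E)
  have hframe := exists_isOrthonormalFrameOn
    ((ambientMetric g).smooth.pullback (Hypersurface.contMDiff_incl F)) (inducedForm_symm (g := g))
    hS.1 ((Hypersurface.proj F).symm p) fun v hv h ↦
      eq_zero_of_isCompl_radical (inducedForm_symm (g := g) _) (hS.2 _) hv h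
  rw [hG.finrank_screen hn hS p] at hframe
  obtain ⟨U, hU, hpU, e, he⟩ := hframe
  have hV : IsOpen ((Hypersurface.proj F).symm ⁻¹' U) :=
    hU.preimage (Hypersurface.proj F).symm.continuous
  obtain ⟨t, ht⟩ : ∃ t : Fin n → Π x : M, TangentSpace I x,
      t = fun j x ↦ e j ((Hypersurface.proj F).symm x) := ⟨_, rfl⟩
  have hts : ∀ j, IsSmoothAlongOn I id (t j) ((Hypersurface.proj F).symm ⁻¹' U) := fun j ↦
    ht ▸ Hypersurface.isSmoothAlongOn_comp_proj_symm F (he.smooth j)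
  have hws : ∀ j, IsSmoothAlongOn I id (fun x ↦ t j x - mvfderiv I F x (t j x) • G x)
      ((Hypersurface.proj F).symm ⁻¹' U) := fun j ↦
    (hts j).sub (.smul ((hts j).contMDiffOn_mvfderiv F.contMDiff) (hG.smooth.mono (subset_univ _)))
  have hwo : ∀ x ∈ (Hypersurface.proj F).symm ⁻¹' U,
      IsPseudoOrthonormal (g.form x) fun j ↦ t j x - mvfderiv I F x (t j x) • G x := fun x hx ↦
    hG.isPseudoOrthonormal_sub_smul x (by rw [ht]; exact he.orthogonal _ hx)
      (by rw [ht]; exact he.unit _ hx)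
  refine ⟨_, hV, hpU, fun j x ↦ t j x - mvfderiv I F x (t j x) • G x, ⟨hws,
    fun x hx ↦ (hwo x hx).span_eq (fun j ↦ hG.sub_smul_mem_kerDiff x _) (hG.finrank_kerDiff hn x),
    fun x hx ↦ (hwo x hx).orthogonal, fun x hx ↦ (hwo x hx).unit⟩, fun x hx ↦ ?_⟩
  -- The test section is the push-forward of $G$, namely $(1,G)$: tangent and normal at once because
  -- $G$ is radical, and nonzero because of its first component.
  obtain ⟨ξ, hξ⟩ : ∃ ξ : Π y : Hypersurface F,
      TangentSpace (𝓘(ℝ, ℝ).prod I) (Hypersurface.incl F y), ξ = fun y ↦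
        mfderiv I (𝓘(ℝ, ℝ).prod I) (Hypersurface.incl F) y (G (Hypersurface.proj F y)) := ⟨_, rfl⟩
  have hξs : IsSmoothAlongOn I (Hypersurface.incl F) ξ U := by
    rw [hξ]
    exact ((Hypersurface.contMDiff_incl F).contMDiff_tangentMap (m := ∞) (by simp)).comp_contMDiffOn
      ((Hypersurface.isSmoothAlongOn_comp_proj F hG.smooth).mono (subset_univ _))
  have hξG : ∀ y, ξ ((Hypersurface.proj F).symm y) =
      (((1 : ℝ), ((1 : ℝ) • G y : TangentSpace I y)) : ℝ × E) := fun y ↦ by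
    rw [hξ]
    refine (Hypersurface.mfderiv_incl F _ (G y)).trans (Prod.ext (hG.mvfderiv_apply y) ?_)
    exact (one_smul ℝ (G y)).symm
  have hξn : ∀ y ∈ U, ξ y ∈ normalSpace I (ambientMetric g).form (Hypersurface.incl F) y ∧
      ξ y ≠ 0 := by
    intro q _
    obtain ⟨y, rfl⟩ := (Hypersurface.proj F).symm.surjective q
    constructor
    · intro v
      have h1 : G y ∈ radical (inducedForm g F) ((Hypersurface.proj F).symm y) :=
        (hG.mem_radical_iff y _).2 (by rw [hG.mvfderiv_apply, one_smul])
      rw [hξ]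
      exact mem_radical.1 h1 v
    · intro h
      exact one_ne_zero (congrArg Prod.fst ((hξG y).symm.trans h : _ = (0 : ℝ × E)))
  have hsum := hmin U hU ξ hξs hξn n e he ((Hypersurface.proj F).symm x) hx
  rw [← neg_eq_zero, ← Finset.sum_neg_distrib, ← hsum]
  refine Finset.sum_congr rfl fun j _ ↦ ?_
  rw [hG.secondFundamentalForm_incl x ξ (hU.mem_nhds hx) (he.smooth j) (hξG x),
    hess_eq_hessCoord g F.contMDiff (hG.form_apply x) _ (hV.mem_nhds hx) (hws j),
    hG.hessCoord_sub_smul, hG.form_sub_smul, ht, neg_one_mul, mul_neg]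
  rfl

/-- At a given point the projected screen frame and the given frame are both orthonormal bases of
$\ker dF$, so they compute the same trace of the Hessian. -/
theorem isMinimal_of_exists_frame [FiniteDimensional ℝ E] [I.Boundaryless]
    (hG : IsUnitGradient g F G) {n : ℕ} (hn : Module.finrank ℝ E = n + 1)
    {S : Π q : Hypersurface F, Submodule ℝ (TangentSpace I q)}
    (hS : IsScreenDistribution (inducedForm g F) S)
    (h : ∀ p : M, ∃ U : Set M, IsOpen U ∧ p ∈ U ∧ ∃ e : Fin n → Π x : M, TangentSpace I x,
      IsOrthonormalFrameOn g.form (kerDiff F) U e ∧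
      ∀ x ∈ U, ∑ j, g.form x (e j x) (e j x) * hess g.form F (e j) (e j) x = 0) :
    IsMinimal (ambientMetric g).form (Hypersurface.incl F) S := by
  intro U hU ξ hξs hξn k e he q hq
  obtain ⟨p, rfl⟩ := (Hypersurface.proj F).symm.surjective q
  have hfd : FiniteDimensional ℝ (TangentSpace I p) := inferInstanceAs (FiniteDimensional ℝ E)
  obtain ⟨V, hV, hpV, f, hf, hsum⟩ := h p
  obtain ⟨t, ht⟩ : ∃ t : Fin k → TangentSpace I p,
      t = fun j ↦ e j ((Hypersurface.proj F).symm p) := ⟨_, rfl⟩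
  have hto : IsPseudoOrthonormal (g.form p) fun j ↦ t j - mvfderiv I F p (t j) • G p :=
    hG.isPseudoOrthonormal_sub_smul p (by rw [ht]; exact he.orthogonal _ hq)
      (by rw [ht]; exact he.unit _ hq)
  have hfo : IsPseudoOrthonormal (g.form p) fun j ↦ f j p := ⟨hf.orthogonal p hpV, hf.unit p hpV⟩
  -- Minimality quantifies over frames of arbitrary length; independence of an orthonormal family
  -- forces the length to be the rank of the screen.
  have hk : k = n := by
    have h1 : IsPseudoOrthonormal (inducedForm g F ((Hypersurface.proj F).symm p))
      fun j ↦ e j ((Hypersurface.proj F).symm p) := ⟨he.orthogonal _ hq, he.unit _ hq⟩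
    have h2 := finrank_span_eq_card h1.linearIndependent
    rw [he.span_eq _ hq, hG.finrank_screen hn hS p, Fintype.card_fin] at h2
    exact h2.symm
  have hspan : Submodule.span ℝ (range fun j ↦ t j - mvfderiv I F p (t j) • G p) =
      Submodule.span ℝ (range fun j ↦ f j p) := by
    rw [hf.span_eq p hpV]
    exact hto.span_eq (fun j ↦ hG.sub_smul_mem_kerDiff p _)
      ((hG.finrank_kerDiff hn p).trans hk.symm)
  obtain ⟨K, hK⟩ : ∃ K : E →L[ℝ] E →L[ℝ] ℝ, K = hessCoord g.form F p (G p) := ⟨_, rfl⟩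
  have htrace := hto.sum_eq_sum (g.symm p) hfo hspan K
  rw [hK] at htrace
  have hzero : ∑ j, g.form p (f j p) (f j p) * hessCoord g.form F p (G p) (f j p) (f j p) = 0 := by
    rw [← hsum p hpV]
    refine Finset.sum_congr rfl fun j _ ↦ ?_
    rw [hess_eq_hessCoord g F.contMDiff (hG.form_apply p) _ (hV.mem_nhds hpV) (hf.smooth j)]
  have hξG := hG.eq_of_mem_normalSpace p (hξn _ hq).1
  have hzero' : ∑ j, inducedForm g F ((Hypersurface.proj F).symm p) (t j) (t j) *
      hessCoord g.form F p (G p) (t j) (t j) = 0 := by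
    refine Eq.trans (Finset.sum_congr rfl fun j _ ↦ ?_) (htrace.trans hzero)
    rw [hG.form_sub_smul]
    exact congrArg _ (hG.hessCoord_sub_smul p _ _).symm
  rw [← mul_zero (-(ξ ((Hypersurface.proj F).symm p) : ℝ × E).1), ← hzero', Finset.mul_sum]
  refine Finset.sum_congr rfl fun j _ ↦ ?_
  rw [hG.secondFundamentalForm_incl p ξ (hU.mem_nhds hq) (he.smooth j) hξG, ht]
  exact mul_left_comm _ _ _

end IsUnitGradient

end Minimal

end MongeType

theorem mainTheorem5 {n : ℕ} {M : Type*} [TopologicalSpace M] [T2Space M]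
    [SecondCountableTopology M] [ChartedSpace (EuclideanSpace ℝ (Fin (n + 1))) M]
    [IsManifold (𝓡 (n + 1)) ∞ M] (g : SemiRiemannianMetric (𝓡 (n + 1)) M)
    (F : C^∞⟮𝓡 (n + 1), M; 𝓘(ℝ, ℝ), ℝ⟯) (hdeg : IsLightlike (inducedForm g F)) :
    IsScreenDistribution (inducedForm g F) (canonicalScreen g F) ∧
    ∀ S : Π q : Hypersurface F, Submodule ℝ (TangentSpace (𝓡 (n + 1)) q),
      IsScreenDistribution (inducedForm g F) S →
      (IsMinimal (ambientMetric g).form (Hypersurface.incl F) S ↔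
        ∀ p : M, ∃ U : Set M, IsOpen U ∧ p ∈ U ∧
          ∃ e : Fin n → Π x : M, TangentSpace (𝓡 (n + 1)) x,
            IsOrthonormalFrameOn g.form (kerDiff F) U e ∧
            ∀ x ∈ U, ∑ j, g.form x (e j x) (e j x) * hess g.form F (e j) (e j) x = 0) := by
  obtain ⟨G, hG⟩ := exists_isUnitGradient hdeg
  have hn : Module.finrank ℝ (EuclideanSpace ℝ (Fin (n + 1))) = n + 1 := finrank_euclideanSpace_fin
  exact ⟨hG.isScreenDistribution_canonicalScreen hn, fun S hS ↦
    ⟨hG.exists_frame_of_isMinimal hn hS, hG.isMinimal_of_exists_frame hn hS⟩⟩
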